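/- Notation. For $c\in\mathbb R$ let $\mathbb H_c=L^2(\mathbb R,e^{-2ct}\,dt)$ (complex-valued functions), and let $\partial=\partial_c=d/dt$ be the infinitesimal shift: the unbounded normal operator on $\mathbb H_c$ with domain $\{f\in\mathbb H_c: f \text{ locally absolutely continuous},\ f'\in\mathbb H_c\}$ and $\partial f=f'$ (almost everywhere derivative); its spectrum is the line $\{\operatorname{Re}s=c\}$. The spectral operator is $\mathfrak a_c=\zeta(\partial_c)$, where $\zeta$ is the Riemann zeta function and functions of normal operators are understood in the sense of the functional calculus. For $c\in(0,1)$ and $T>0$, let $\varphi_c^{(T)}$ be a cut-off function, that is, a continuous function $\varphi_c^{(T)}:\{\operatorname{Re}s=c\}\to\mathbb C$ such that the closure of its range is the segment $[c-iT,c+iT]$; put $\partial_c^{(T)}=\varphi_c^{(T)}(\partial_c)$ (a bounded normal operator) and $\mathfrak a_c^{(T)}=\zeta(\partial_c^{(T)})$. The spectral operator $\mathfrak a_c$ is called quasi-invertible if, for every $T>0$, the bounded operator $\mathfrak a_c^{(T)}$ on $\mathbb H_c$ is invertible. Theorem. For any choice of the cut-off functions $\varphi_c^{(T)}$ ($c\in(0,1)$,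 $T>0$): (a) $\mathfrak a_c$ is quasi-invertible for every $c\in(0,1)$ with $c\neq 1/2$ if and only if the Riemann hypothesis is true; (b) equivalently, $\mathfrak a_c$ is quasi-invertible for every $c\in(0,1/2)$ if and only if the Riemann hypothesis is true. -/

import Mathlib

open MeasureTheory Set
open scoped ENNReal

/-- A projection-valued measure (resolution of the identity) on the Borel sets of `ℂ`, with values
in the orthogonal projections of the Hilbert space `H`. -/
structure ProjectionValuedMeasure (H : Type*) [NormedAddCommGroup H] [InnerProductSpace ℂ H]
    [CompleteSpace H] where
  /-- The projection attached to a Borel set (values at other sets are irrelevant). -/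
  proj : Set ℂ → (H →L[ℂ] H)
  isStarProjection : ∀ B, MeasurableSet B → IsStarProjection (proj B)
  proj_empty : proj ∅ = 0
  proj_univ : proj univ = 1
  proj_inter : ∀ A B, MeasurableSet A → MeasurableSet B → proj (A ∩ B) = proj A * proj B
  hasSum_proj : ∀ B : ℕ → Set ℂ, (∀ n, MeasurableSet (B n)) → Pairwise (Function.onFun Disjoint B) →
    ∀ x : H, HasSum (fun n => proj (B n) x) (proj (⋃ n, B n) x)

namespace ProjectionValuedMeasure

variable {H : Type*} [NormedAddCommGroup H] [InnerProductSpace ℂ H] [CompleteSpace H]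

theorem inner_proj_nonneg (E : ProjectionValuedMeasure H) (x : H) {B : Set ℂ}
    (hB : MeasurableSet B) : 0 ≤ (inner ℂ x (E.proj B x)).re := by
  have hp := E.isStarProjection B hB
  have h1 : E.proj B (E.proj B x) = E.proj B x := by
    have := congrArg (fun L : H →L[ℂ] H => L x) hp.isIdempotentElem
    simpa using this
  have h2 : inner ℂ x (E.proj B x) = inner ℂ (E.proj B x) (E.proj B x) := by
    conv_lhs => rw [← h1]
    rw [← ContinuousLinearMap.adjoint_inner_left, ← ContinuousLinearMap.star_eq_adjoint,
      hp.isSelfAdjoint.star_eq]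
  rw [h2]
  exact inner_self_nonneg (𝕜 := ℂ) (x := E.proj B x)

/-- The finite positive Borel measure `E_{x,x} : B ↦ ⟪x, E(B) x⟫` on `ℂ`. -/
noncomputable def scalarMeasure (E : ProjectionValuedMeasure H) (x : H) : Measure ℂ :=
  Measure.ofMeasurable (fun B _ => ENNReal.ofReal (inner ℂ x (E.proj B x)).re)
    (by simp [E.proj_empty])
    (by
      intro B hB hd
      have h := E.hasSum_proj B hB hd x
      have h2 : HasSum (fun n => (inner ℂ x (E.proj (B n) x)).re)
          (inner ℂ x (E.proj (⋃ n, B n) x)).re :=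
        Complex.hasSum_re (h.mapL (innerSL ℂ x))
      rw [← h2.tsum_eq]
      exact ENNReal.ofReal_tsum_of_nonneg (fun n => E.inner_proj_nonneg x (hB n)) h2.summable)

/-- `A = ∫ f dE` for a (possibly unbounded) operator `A`: the domain of `A` is
`{x | ∫ |f|² dE_{x,x} < ∞}`, and `⟪x, A x⟫ = ∫ f dE_{x,x}` for all `x` in it. As the domain is a
dense subspace, by polarization this is the same as `⟪y, A x⟫ = ∫ f dE_{x,y}` for all `y`. -/
def IsIntegral (E : ProjectionValuedMeasure H) (f : ℂ → ℂ) (A : H →ₗ.[ℂ] H) : Prop :=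
  (∀ x : H, x ∈ A.domain ↔ ∫⁻ z, ‖f z‖ₑ ^ 2 ∂(E.scalarMeasure x) < ∞) ∧
  ∀ x : A.domain, inner ℂ (x : H) (A x) = ∫ z, f z ∂(E.scalarMeasure (x : H))

/-- `E` is the spectral measure of the operator `N`, i.e. `N = ∫ z dE(z)`. -/
def IsSpectralMeasureOf (E : ProjectionValuedMeasure H) (N : H →ₗ.[ℂ] H) : Prop :=
  E.IsIntegral (fun z => z) N

end ProjectionValuedMeasure

section FunctionalCalculus

variable {H : Type*} [NormedAddCommGroup H] [InnerProductSpace ℂ H] [CompleteSpace H]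

/-- `A = f(N)` in the sense of the functional calculus for unbounded normal operators:
`A = ∫ f dE`, where `E` is the spectral measure of `N`. -/
def IsFunctionOf (f : ℂ → ℂ) (N A : H →ₗ.[ℂ] H) : Prop :=
  ∃ E : ProjectionValuedMeasure H, E.IsSpectralMeasureOf N ∧ E.IsIntegral f A

/-- The operator `f(N)`. For `N` normal and `f` Borel measurable almost everywhere with respect to
the spectral measure of `N`, there is exactly one such operator, by the spectral theorem. -/
noncomputable def functionOf (f : ℂ → ℂ) (N : H →ₗ.[ℂ] H) : H →ₗ.[ℂ] H :=
  Classical.epsilon fun A => IsFunctionOf f N A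

/-- The operator `f(N)` as an everywhere defined bounded operator. For `N` normal and `f` as in
`functionOf` and bounded on the spectrum of `N`, there is exactly one such operator. -/
noncomputable def boundedFunctionOf (f : ℂ → ℂ) (N : H →ₗ.[ℂ] H) : H →L[ℂ] H :=
  Classical.epsilon fun A => IsFunctionOf f N ((A : H →ₗ[ℂ] H).toPMap ⊤)

end FunctionalCalculus

/-- The measure `e^{-2ct} dt` on the real line. -/
noncomputable def weightedMeasure (c : ℝ) : Measure ℝ :=
  volume.withDensity fun t => ENNReal.ofReal (Real.exp (-2 * c * t))

/-- The complex Hilbert space `ℍ_c = L²(ℝ, e^{-2ct} dt)`. -/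
abbrev WeightedL2 (c : ℝ) : Type := Lp ℂ 2 (weightedMeasure c)

/-- The graph of `d/dt` on `ℍ_c`: the pairs `(f, h)` in `ℍ_c × ℍ_c` such that `f` is (represented
by) a locally absolutely continuous function `g` whose pointwise a.e. derivative is `h`. -/
def derivGraph (c : ℝ) : Submodule ℂ (WeightedL2 c × WeightedL2 c) where
  carrier := {p | ∃ g : ℝ → ℂ, (∀ a b : ℝ, AbsolutelyContinuousOnInterval g a b) ∧
    (p.1 =ᵐ[weightedMeasure c] g) ∧ ∀ᵐ t ∂(weightedMeasure c), HasDerivAt g (p.2 t) t}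
  zero_mem' := by
    refine ⟨0, fun a b => ?_, Lp.coeFn_zero _ _ _, ?_⟩
    · exact ((LipschitzWith.const (0 : ℂ)).lipschitzOnWith).absolutelyContinuousOnInterval
    · filter_upwards [Lp.coeFn_zero ℂ 2 (weightedMeasure c)] with t ht
      rw [Prod.snd_zero, ht]
      exact hasDerivAt_const t (0 : ℂ)
  add_mem' := by
    rintro p q ⟨g, hg, hpg, hg'⟩ ⟨k, hk, hqk, hk'⟩
    refine ⟨g + k, fun a b => (hg a b).add (hk a b), ?_, ?_⟩
    · exact (Lp.coeFn_add p.1 q.1).trans (hpg.add hqk)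
    · filter_upwards [Lp.coeFn_add p.2 q.2, hg', hk'] with t h1 h2 h3
      rw [Prod.snd_add, h1]
      exact h2.add h3
  smul_mem' := by
    rintro r p ⟨g, hg, hpg, hg'⟩
    refine ⟨r • g, fun a b => (hg a b).const_smul r, ?_, ?_⟩
    · exact (Lp.coeFn_smul r p.1).trans (hpg.const_smul r)
    · filter_upwards [Lp.coeFn_smul r p.2, hg'] with t h1 h2
      rw [Prod.smul_snd, h1]
      exact h2.const_smul r

theorem ae_weightedMeasure_iff (c : ℝ) {p : ℝ → Prop} :
    (∀ᵐ t ∂(weightedMeasure c), p t) ↔ ∀ᵐ t : ℝ, p t := by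
  have h1 : weightedMeasure c ≪ volume := withDensity_absolutelyContinuous _ _
  have h2 : volume ≪ weightedMeasure c :=
    withDensity_absolutelyContinuous' (by fun_prop)
      (Filter.Eventually.of_forall fun t => by simp [Real.exp_pos])
  exact ⟨fun h => h2.ae_le h, fun h => h1.ae_le h⟩

/-- The derivative is well defined: `derivGraph c` is the graph of an operator. -/
theorem derivGraph_singleValued (c : ℝ) (p : WeightedL2 c × WeightedL2 c)
    (hp : p ∈ derivGraph c) (h0 : p.1 = 0) : p.2 = 0 := by
  obtain ⟨g, hg, hpg, hg'⟩ := hp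
  have hcont : Continuous g := by
    rw [continuous_iff_continuousAt]
    intro t
    refine (hg (t - 1) (t + 1)).continuousOn.continuousAt ?_
    rw [uIcc_of_le (by linarith)]
    exact Icc_mem_nhds (by linarith) (by linarith)
  have hz : g = fun _ => 0 := by
    refine (hcont.ae_eq_iff_eq volume continuous_const).1 ?_
    refine (ae_weightedMeasure_iff c).1 ?_
    have h3 := Lp.coeFn_zero ℂ 2 (weightedMeasure c)
    rw [h0] at hpg
    filter_upwards [hpg, h3] with t h1 h2
    rw [← h1, h2]; rfl
  refine Lp.ext ?_
  filter_upwards [hg', Lp.coeFn_zero ℂ 2 (weightedMeasure c)] with t h1 h2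
  rw [h2, hz] at *
  exact h1.unique (hasDerivAt_const t (0 : ℂ))

/-- The infinitesimal shift `∂ = d/dt` on `ℍ_c`, with domain
`{f ∈ C_abs(ℝ) ∩ ℍ_c : f' ∈ ℍ_c}`. -/
noncomputable def infinitesimalShift (c : ℝ) : WeightedL2 c →ₗ.[ℂ] WeightedL2 c :=
  (derivGraph c).toLinearPMap

theorem infinitesimalShift_graph (c : ℝ) : (infinitesimalShift c).graph = derivGraph c :=
  Submodule.toLinearPMap_graph_eq _ fun p hp h0 => derivGraph_singleValued c p hp h0

/-- The spectral operator `𝔞_c = ζ(∂)`. -/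
noncomputable def spectralOperator (c : ℝ) : WeightedL2 c →ₗ.[ℂ] WeightedL2 c :=
  functionOf riemannZeta (infinitesimalShift c)

/-- Admissible cut-off functions at height `T` on the line `Re s = c` (for `c ≠ 1`): continuous on
the line, with range dense in the segment `[c - iT, c + iT]`, and contained in it. -/
def IsCutoff (c T : ℝ) (φ : ℂ → ℂ) : Prop :=
  ContinuousOn φ {s | s.re = c} ∧
  closure (φ '' {s | s.re = c}) = segment ℝ (c - T * Complex.I : ℂ) (c + T * Complex.I : ℂ)

/-- The truncated infinitesimal shift `∂^(T) = φ(∂)`, for a cut-off function `φ` at height `T`. -/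
noncomputable def truncatedShift (c : ℝ) (φ : ℂ → ℂ) : WeightedL2 c →L[ℂ] WeightedL2 c :=
  boundedFunctionOf φ (infinitesimalShift c)

/-- The truncated spectral operator `𝔞^(T) = ζ(∂^(T))` (for `c ≠ 1`, so that `ζ` is continuous on
the spectrum of the bounded normal operator `∂^(T)`), by the continuous functional calculus. -/
noncomputable def truncatedSpectralOperator (c : ℝ) (φ : ℂ → ℂ) :
    WeightedL2 c →L[ℂ] WeightedL2 c :=
  cfc riemannZeta (truncatedShift c φ)

/-- The spectral operator `𝔞_c` is quasi-invertible (for `c ≠ 1`), with respect to the cut-off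
functions `φ T`: all its truncations `𝔞^(T)`, `T > 0`, are invertible bounded operators. -/
def SpectralOperatorQuasiInvertible (c : ℝ) (φ : ℝ → ℂ → ℂ) : Prop :=
  ∀ T : ℝ, 0 < T → IsUnit (truncatedSpectralOperator c (φ T))

/-! The truncation `∂^(T)` is normal and its spectrum is the closure of the range of the cut-off
over the line `Re s = c`, that is, the segment `[c - iT, c + iT]`. By spectral mapping `ζ(∂^(T))` is
invertible iff `ζ` has no zero on that segment, so quasi-invertibility at `c` means that `ζ` has no
zero on `Re s = c`. The functional equation and the absence of zeros for `Re s ≥ 1` then turn both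
conditions into the Riemann hypothesis.

The operator-theoretic work is in the spectrum of `φ(∂)`
(`isStarNormal_and_spectrum_boundedFunctionOf`). Existence of `φ(∂)` comes from the Fourier
transform: `f ↦ 𝓕(e^{-ct} f)` turns `∂` into multiplication by `c + 2πiξ`
(`mem_derivGraph_iff_twistedFourier`). The operator named by `boundedFunctionOf` satisfies its
definition for some spectral measure `E` that need not visibly be the Fourier one. Instead of
proving uniqueness of `E`, the argument shows that every spectral measure of `∂` vanishes off the
line (`proj_compl_verticalLine`) and charges every ball centred on it (`mul_norm_le` together with
approximate eigenvectors of `∂`). These two facts already determine the spectrum of `∫ φ dE`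
(`spectrum_eq_closure`). -/

/-! ### Operator norm and numerical radius. -/

section NumericalRadius

variable {H : Type*} [NormedAddCommGroup H] [InnerProductSpace ℂ H]

/-- Complex polarization followed by the parallelogram law. `IsIntegral` prescribes only quadratic
forms, so this is the passage from them to operator norms. -/
theorem ContinuousLinearMap.norm_le_two_mul_of_norm_inner_le {B : H →L[ℂ] H} {ε : ℝ} (hε : 0 ≤ ε)
    (h : ∀ x, ‖inner ℂ x (B x)‖ ≤ ε * ‖x‖ ^ 2) : ‖B‖ ≤ 2 * ε := by
  have key : ∀ x y : H, ‖inner ℂ y (B x)‖ ≤ ε * (‖x‖ ^ 2 + ‖y‖ ^ 2) := by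
    intro x y
    have e : (4 : ℂ) * inner ℂ y (B x) = inner ℂ (x + y) (B (x + y)) - inner ℂ (x - y) (B (x - y))
        + Complex.I * inner ℂ (x + Complex.I • y) (B (x + Complex.I • y))
        - Complex.I * inner ℂ (x - Complex.I • y) (B (x - Complex.I • y)) := by
      simp only [map_add, map_sub, map_smul, inner_add_left, inner_add_right, inner_sub_left,
        inner_sub_right, inner_smul_left, inner_smul_right, Complex.conj_I]
      ring_nf
      simp only [Complex.I_sq]
      ring
    have h4 : 4 * ‖inner ℂ y (B x)‖ ≤ ε * ‖x + y‖ ^ 2 + ε * ‖x - y‖ ^ 2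
        + ε * ‖x + Complex.I • y‖ ^ 2 + ε * ‖x - Complex.I • y‖ ^ 2 := by
      have : ‖(4 : ℂ) * inner ℂ y (B x)‖ = 4 * ‖inner ℂ y (B x)‖ := by simp
      rw [← this, e]
      refine (norm_sub_le _ _).trans (add_le_add ((norm_add_le _ _).trans (add_le_add
        ((norm_sub_le _ _).trans (add_le_add (h _) (h _))) ?_)) ?_)
      · simpa using h (x + Complex.I • y)
      · simpa using h (x - Complex.I • y)
    have p1 := parallelogram_law_with_norm ℂ x y
    have p2 := parallelogram_law_with_norm ℂ x (Complex.I • y)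
    have n : ‖Complex.I • y‖ = ‖y‖ := by simp [norm_smul]
    rw [n] at p2
    nlinarith
  refine B.opNorm_le_bound (by positivity) fun x => ?_
  rcases eq_or_ne (B x) 0 with h0 | h0
  · rw [h0, norm_zero]; positivity
  have hx : x ≠ 0 := fun hx => h0 (by simp [hx])
  have hBx : (0 : ℝ) < ‖B x‖ := norm_pos_iff.2 h0
  have hxp : (0 : ℝ) < ‖x‖ := norm_pos_iff.2 hx
  -- The test vector is `B x` rescaled to norm `‖x‖`, which balances the two squares in `key`.
  have k := key x (((‖x‖ / ‖B x‖ : ℝ) : ℂ) • B x)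
  rw [inner_smul_left, inner_self_eq_norm_sq_to_K, norm_smul] at k
  simp only [Complex.conj_ofReal, norm_mul, Complex.norm_real, norm_div, norm_norm, norm_pow,
    Complex.coe_algebraMap] at k
  have e1 : ‖x‖ / ‖B x‖ * ‖B x‖ = ‖x‖ := div_mul_cancel₀ _ hBx.ne'
  have e2 : ‖x‖ / ‖B x‖ * ‖B x‖ ^ 2 = ‖x‖ * ‖B x‖ := by rw [sq, ← mul_assoc, e1]
  rw [e1, e2] at k
  have : ‖x‖ * ‖B x‖ ≤ ‖x‖ * (2 * ε * ‖x‖) := by nlinarith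
  exact le_of_mul_le_mul_left this hxp

end NumericalRadius

/-! ### Scalar measures and the calculus of simple functions. -/

namespace ProjectionValuedMeasure

variable {H : Type*} [NormedAddCommGroup H] [InnerProductSpace ℂ H] [CompleteSpace H]
  (E : ProjectionValuedMeasure H)

theorem proj_proj_apply (x : H) {A B : Set ℂ} (hA : MeasurableSet A) (hB : MeasurableSet B) :
    E.proj A (E.proj B x) = E.proj (A ∩ B) x := by
  rw [E.proj_inter A B hA hB]; rfl

theorem inner_proj_left (x y : H) {B : Set ℂ} (hB : MeasurableSet B) :
    inner ℂ (E.proj B x) y = inner ℂ x (E.proj B y) := by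
  rw [← ContinuousLinearMap.adjoint_inner_right, ← ContinuousLinearMap.star_eq_adjoint,
    (E.isStarProjection B hB).isSelfAdjoint.star_eq]

theorem inner_proj_self (x : H) {B : Set ℂ} (hB : MeasurableSet B) :
    inner ℂ x (E.proj B x) = ((‖E.proj B x‖ ^ 2 : ℝ) : ℂ) := by
  have : E.proj B x = E.proj B (E.proj B x) := by
    rw [E.proj_proj_apply x hB hB, inter_self]
  rw [this, ← E.inner_proj_left _ _ hB, ← this, inner_self_eq_norm_sq_to_K]
  simp

theorem scalarMeasure_apply (x : H) {B : Set ℂ} (hB : MeasurableSet B) :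
    E.scalarMeasure x B = ENNReal.ofReal (‖E.proj B x‖ ^ 2) := by
  rw [scalarMeasure, Measure.ofMeasurable_apply _ hB, E.inner_proj_self x hB, Complex.ofReal_re]

theorem scalarMeasure_real_apply (x : H) {B : Set ℂ} (hB : MeasurableSet B) :
    (E.scalarMeasure x).real B = ‖E.proj B x‖ ^ 2 := by
  rw [Measure.real, E.scalarMeasure_apply x hB, ENNReal.toReal_ofReal (by positivity)]

instance isFiniteMeasure_scalarMeasure (x : H) : IsFiniteMeasure (E.scalarMeasure x) :=
  ⟨by rw [E.scalarMeasure_apply x .univ]; exact ENNReal.ofReal_lt_top⟩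

theorem scalarMeasure_real_univ (x : H) : (E.scalarMeasure x).real univ = ‖x‖ ^ 2 := by
  rw [E.scalarMeasure_real_apply x .univ, E.proj_univ]; rfl

theorem scalarMeasure_proj (x : H) {B : Set ℂ} (hB : MeasurableSet B) :
    E.scalarMeasure (E.proj B x) = (E.scalarMeasure x).restrict B := by
  ext C hC
  rw [Measure.restrict_apply hC, E.scalarMeasure_apply _ hC, E.scalarMeasure_apply _ (hC.inter hB),
    E.proj_proj_apply x hC hB]

theorem scalarMeasure_smul (a : ℂ) (x : H) :
    E.scalarMeasure (a • x) = ENNReal.ofReal (‖a‖ ^ 2) • E.scalarMeasure x := by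
  ext C hC
  rw [Measure.smul_apply, E.scalarMeasure_apply _ hC, E.scalarMeasure_apply _ hC, map_smul,
    norm_smul, mul_pow, ENNReal.ofReal_mul (by positivity), smul_eq_mul]

theorem proj_add_proj_compl (x : H) {B : Set ℂ} (hB : MeasurableSet B) :
    E.proj B x + E.proj Bᶜ x = x := by
  have h := E.hasSum_proj (fun n => if n = 0 then B else if n = 1 then Bᶜ else ∅)
    (fun n => by split_ifs; exacts [hB, hB.compl, .empty])
    (by
      intro i j hij
      simp only [Function.onFun]
      split_ifs <;> simp_all [disjoint_compl_right, disjoint_compl_left])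
    x
  have hU : (⋃ n : ℕ, (if n = 0 then B else if n = 1 then Bᶜ else ∅)) = univ := by
    refine eq_univ_of_forall fun z => ?_
    by_cases hz : z ∈ B
    · exact mem_iUnion.2 ⟨0, by simpa using hz⟩
    · exact mem_iUnion.2 ⟨1, by simpa using hz⟩
  rw [hU, E.proj_univ] at h
  have h2 := hasSum_sum_of_ne_finset_zero (L := .unconditional ℕ) (f := fun n : ℕ =>
    E.proj (if n = 0 then B else if n = 1 then Bᶜ else ∅) x) (s := Finset.range 2) (by
      intro b hb
      simp only [Finset.mem_range, not_lt] at hb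
      rw [if_neg (by omega), if_neg (by omega), E.proj_empty]; rfl)
  simpa [Finset.sum_range_succ] using h2.unique h

theorem proj_mono_zero {A B : Set ℂ} (hA : MeasurableSet A) (hB : MeasurableSet B) (h : A ⊆ B)
    (h0 : E.proj B = 0) : E.proj A = 0 := by
  rw [← inter_eq_self_of_subset_left h, E.proj_inter A B hA hB, h0, mul_zero]

theorem proj_eq_zero_iff {B : Set ℂ} (hB : MeasurableSet B) :
    E.proj B = 0 ↔ ∀ x, E.scalarMeasure x B = 0 := by
  refine ⟨fun h x => by rw [E.scalarMeasure_apply x hB, h]; simp, fun h => ?_⟩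
  ext x
  have := h x
  rw [E.scalarMeasure_apply x hB, ENNReal.ofReal_eq_zero] at this
  simpa using this

/-- On a complex space an operator is determined by its quadratic form; here both forms equal the
total mass of `E.scalarMeasure x`, split along the fibres of `s`. -/
theorem sum_proj_fiber (s : SimpleFunc ℂ ℂ) :
    ∑ v ∈ s.range, E.proj (s ⁻¹' {v}) = 1 := by
  refine ContinuousLinearMap.ext fun x => ext_inner_left ℂ fun y => ?_
  revert x y
  suffices h : (∑ v ∈ s.range, E.proj (s ⁻¹' {v}) : H →L[ℂ] H).toLinearMap
      = (1 : H →L[ℂ] H).toLinearMap by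
    intro x y; exact congrArg _ (LinearMap.congr_fun h x)
  rw [← ext_inner_map]
  intro x
  rw [← inner_conj_symm, ← inner_conj_symm ((1 : H →L[ℂ] H).toLinearMap x)]
  congr 1
  have h1 : ∑ v ∈ s.range, (E.scalarMeasure x).real (s ⁻¹' {v}) = ‖x‖ ^ 2 := by
    have hu : (univ : Set ℂ) = s ⁻¹' s.range := by ext z; simp
    rw [← E.scalarMeasure_real_univ x, Measure.real, hu, ← s.sum_measure_preimage_singleton s.range]
    · rw [ENNReal.toReal_sum (fun _ _ => measure_ne_top _ _)]
      simp only [Measure.real]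
  simp only [ContinuousLinearMap.coe_coe, _root_.sum_apply, inner_sum,
    one_apply_eq_self, inner_self_eq_norm_sq_to_K]
  simp_rw [E.inner_proj_self x (s.measurableSet_fiber _)]
  simp_rw [← E.scalarMeasure_real_apply x (s.measurableSet_fiber _)]
  rw [← Complex.ofReal_sum, h1]
  simp

theorem proj_fiber_mul_proj_fiber (s : SimpleFunc ℂ ℂ) (v w : ℂ) :
    E.proj (s ⁻¹' {v}) * E.proj (s ⁻¹' {w}) = if v = w then E.proj (s ⁻¹' {v}) else 0 := by
  rw [← E.proj_inter _ _ (s.measurableSet_fiber _) (s.measurableSet_fiber _)]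
  split_ifs with h
  · rw [h, inter_self]
  · rw [← preimage_inter, singleton_inter_eq_empty.2 (by simpa using h), preimage_empty,
      E.proj_empty]

/-- The functional calculus `g ↦ ∫ g ∘ s dE` attached to a simple function `s`. -/
noncomputable def simpleCalculus (s : SimpleFunc ℂ ℂ) : (s.range → ℂ) →⋆ₐ[ℂ] (H →L[ℂ] H) where
  toFun g := ∑ v : s.range, g v • E.proj (s ⁻¹' {(v : ℂ)})
  map_one' := by
    simp only [Pi.one_apply, one_smul]
    rw [← E.sum_proj_fiber s, ← Finset.sum_coe_sort s.range]
  map_mul' g h := by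
    rw [Finset.sum_mul]
    refine Finset.sum_congr rfl fun v _ => ?_
    rw [Finset.mul_sum, Finset.sum_eq_single v]
    · rw [smul_mul_smul_comm, E.proj_fiber_mul_proj_fiber, if_pos rfl, Pi.mul_apply]
    · intro w _ hw
      rw [smul_mul_smul_comm, E.proj_fiber_mul_proj_fiber,
        if_neg fun h => hw (Subtype.ext h.symm), smul_zero]
    · simp
  map_zero' := by simp
  map_add' g h := by simp [add_smul, Finset.sum_add_distrib]
  commutes' r := by
    simp only [Pi.algebraMap_apply, Algebra.algebraMap_self, RingHom.id_apply]
    rw [← Finset.smul_sum, Finset.sum_coe_sort s.range (fun v => E.proj (s ⁻¹' {v})),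
      E.sum_proj_fiber s, Algebra.algebraMap_eq_smul_one]
  map_star' g := by
    rw [star_sum]
    refine Finset.sum_congr rfl fun v _ => ?_
    rw [star_smul, (E.isStarProjection _ (s.measurableSet_fiber _)).isSelfAdjoint.star_eq]
    rfl

theorem simpleCalculus_apply (s : SimpleFunc ℂ ℂ) (g : s.range → ℂ) :
    E.simpleCalculus s g = ∑ v : s.range, g v • E.proj (s ⁻¹' {(v : ℂ)}) := rfl

/-- The operator `∫ s dE` for a simple function `s`. -/
noncomputable def simpleIntegral (s : SimpleFunc ℂ ℂ) : H →L[ℂ] H :=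
  E.simpleCalculus s Subtype.val

theorem inner_simpleIntegral (s : SimpleFunc ℂ ℂ) (x : H) :
    inner ℂ x (E.simpleIntegral s x) = ∫ z, s z ∂(E.scalarMeasure x) := by
  rw [← SimpleFunc.integral_eq_integral s (SimpleFunc.integrable_of_isFiniteMeasure s),
    SimpleFunc.integral_eq, simpleIntegral, simpleCalculus_apply, _root_.sum_apply,
    inner_sum, ← Finset.sum_coe_sort s.range]
  refine Finset.sum_congr rfl fun v _ => ?_
  rw [_root_.smul_apply, inner_smul_right,
    E.inner_proj_self x (s.measurableSet_fiber _),
    ← E.scalarMeasure_real_apply x (s.measurableSet_fiber _), mul_comm]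
  rfl

theorem isStarNormal_simpleIntegral (s : SimpleFunc ℂ ℂ) : IsStarNormal (E.simpleIntegral s) := by
  have : IsStarNormal (Subtype.val : s.range → ℂ) := ⟨mul_comm _ _⟩
  exact this.map (E.simpleCalculus s)

end ProjectionValuedMeasure

/-! ### Normality and spectrum of `∫ f dE` for `f` bounded and continuous on a closed set carrying
`E`. -/

theorem exists_simpleFunc_approx {S : Set ℂ} (hS : IsClosed S) (hne : S.Nonempty) {f : ℂ → ℂ}
    (hf : ContinuousOn f S) (hb : Bornology.IsBounded (f '' S)) {ε : ℝ} (hε : 0 < ε) :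
    ∃ s : SimpleFunc ℂ ℂ, (∀ z ∈ S, ‖f z - s z‖ ≤ ε) ∧ ∀ z, s z ∈ f '' S := by
  classical
  obtain ⟨w, hw⟩ := hne
  -- Nothing is known about `f` off `S`, so it is replaced there by one of its values on `S`.
  have hmeas : Measurable (S.piecewise f fun _ => f w) := by
    refine measurable_of_restrict_of_restrict_compl hS.measurableSet ?_ ?_
    · rw [domRestrict_piecewise]; exact hf.domRestrict.measurable
    · rw [domRestrict_piecewise_compl]; exact measurable_const
  have htb : TotallyBounded (f '' S) := Metric.isCompact_of_isClosed_isBounded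
    isClosed_closure hb.closure |>.totallyBounded.subset subset_closure
  obtain ⟨t, hts, htf, ht⟩ := Metric.finite_approx_of_totallyBounded htb ε hε
  obtain ⟨y, hy, -⟩ := mem_iUnion₂.1 (ht (mem_image_of_mem f hw))
  set l := htf.toFinset.toList with hl
  have hlt : ∀ {u}, u ∈ l ↔ u ∈ t := by simp [hl]
  -- `nearestPt` with bound `l.length` also tries the index `l.length`, just past the end of the
  -- list; the default `y ∈ t` keeps that value in the net, hence in `f '' S`.
  have he : ∀ k, l.getD k y ∈ t := fun k => by
    rcases lt_or_ge k l.length with hk | hk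
    · rw [List.getD_eq_getElem _ _ hk]; exact hlt.1 (List.getElem_mem hk)
    · rw [List.getD_eq_default _ _ hk]; exact hy
  refine ⟨(SimpleFunc.nearestPt (fun k => l.getD k y) l.length).comp _ hmeas, fun z hz => ?_,
    fun z => hts (he _)⟩
  obtain ⟨u, hu, hzu⟩ := mem_iUnion₂.1 (ht (mem_image_of_mem f hz))
  obtain ⟨k, hk, rfl⟩ := List.getElem_of_mem (hlt.2 hu)
  have h1 := SimpleFunc.edist_nearestPt_le (fun k => l.getD k y) (f z) hk.le
  rw [List.getD_eq_getElem _ _ hk, edist_dist, edist_dist,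
    ENNReal.ofReal_le_ofReal_iff dist_nonneg] at h1
  rw [SimpleFunc.coe_comp, Function.comp_apply, piecewise_eq_of_mem _ _ _ hz, ← dist_eq_norm,
    dist_comm]
  exact h1.trans (by rw [dist_comm]; exact (Metric.mem_ball.1 hzu).le)

namespace ProjectionValuedMeasure

variable {H : Type*} [NormedAddCommGroup H] [InnerProductSpace ℂ H] [CompleteSpace H]
  (E : ProjectionValuedMeasure H)

theorem ae_mem_of_proj_compl {S : Set ℂ} (hS : MeasurableSet S) (h : E.proj Sᶜ = 0) (x : H) :
    ∀ᵐ z ∂(E.scalarMeasure x), z ∈ S :=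
  (E.proj_eq_zero_iff hS.compl).1 h x

theorem integrable_of_continuousOn {S : Set ℂ} (hS : IsClosed S) (hES : E.proj Sᶜ = 0)
    {f : ℂ → ℂ} (hf : ContinuousOn f S) (hb : Bornology.IsBounded (f '' S)) (x : H) :
    Integrable f (E.scalarMeasure x) := by
  obtain ⟨C, hC⟩ := hb.exists_norm_le
  have hae := E.ae_mem_of_proj_compl hS.measurableSet hES x
  have hr : (E.scalarMeasure x).restrict S = E.scalarMeasure x :=
    Measure.restrict_eq_self_of_ae_mem hae
  refine Integrable.of_bound (C := C) ?_ ?_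
  · rw [← hr]
    exact hf.aestronglyMeasurable hS.measurableSet
  · filter_upwards [hae] with z hz using hC _ (mem_image_of_mem f hz)

/-- The quadratic form of the difference is `∫ (f - s) dE_{x,x}`, at most `ε ‖x‖²`. Every property
of `A` below is transferred from simple functions through this estimate. -/
theorem norm_sub_simpleIntegral_le {S : Set ℂ} (hS : IsClosed S) (hES : E.proj Sᶜ = 0)
    {f : ℂ → ℂ} (hf : ContinuousOn f S) (hb : Bornology.IsBounded (f '' S)) {A : H →L[ℂ] H}
    (hA : ∀ x, inner ℂ x (A x) = ∫ z, f z ∂(E.scalarMeasure x)) {s : SimpleFunc ℂ ℂ} {ε : ℝ}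
    (hε : 0 ≤ ε) (hs : ∀ z ∈ S, ‖f z - s z‖ ≤ ε) : ‖A - E.simpleIntegral s‖ ≤ 2 * ε := by
  refine ContinuousLinearMap.norm_le_two_mul_of_norm_inner_le hε fun x => ?_
  rw [_root_.sub_apply, inner_sub_right, hA, E.inner_simpleIntegral,
    ← integral_sub (E.integrable_of_continuousOn hS hES hf hb x)
      (SimpleFunc.integrable_of_isFiniteMeasure s), ← E.scalarMeasure_real_univ x]
  refine norm_integral_le_of_norm_le_const ?_
  filter_upwards [E.ae_mem_of_proj_compl hS.measurableSet hES x] with z hz using hs z hz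

theorem isStarNormal_of_isIntegral {S : Set ℂ} (hS : IsClosed S) (hne : S.Nonempty)
    (hES : E.proj Sᶜ = 0) {f : ℂ → ℂ} (hf : ContinuousOn f S) (hb : Bornology.IsBounded (f '' S))
    {A : H →L[ℂ] H} (hA : ∀ x, inner ℂ x (A x) = ∫ z, f z ∂(E.scalarMeasure x)) :
    IsStarNormal A := by
  have hcl : IsClosed {B : H →L[ℂ] H | IsStarNormal B} := by
    have : {B : H →L[ℂ] H | IsStarNormal B} = {B | star B * B = B * star B} := by
      ext B; exact isStarNormal_iff B
    rw [this]
    exact isClosed_eq (by fun_prop) (by fun_prop)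
  refine hcl.closure_subset (Metric.mem_closure_iff.2 fun ε hε => ?_)
  obtain ⟨s, hs, -⟩ := exists_simpleFunc_approx hS hne hf hb (ε := ε / 3) (by positivity)
  refine ⟨_, E.isStarNormal_simpleIntegral s, ?_⟩
  rw [dist_eq_norm]
  exact (E.norm_sub_simpleIntegral_le hS hES hf hb hA (by positivity) hs).trans_lt (by linarith)

/-- A simple function with values in `f '' S` stays at distance `δ` from `l`, so its integral has an
explicit resolvent at `l`, of norm at most `δ⁻¹`; a Neumann series then absorbs the approximation
error. -/
theorem isUnit_sub_of_notMem_closure {S : Set ℂ} (hS : IsClosed S) (hne : S.Nonempty)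
    (hES : E.proj Sᶜ = 0) {f : ℂ → ℂ} (hf : ContinuousOn f S) (hb : Bornology.IsBounded (f '' S))
    {A : H →L[ℂ] H} (hA : ∀ x, inner ℂ x (A x) = ∫ z, f z ∂(E.scalarMeasure x)) {l : ℂ}
    (hl : l ∉ closure (f '' S)) : IsUnit (algebraMap ℂ (H →L[ℂ] H) l - A) := by
  obtain ⟨δ, hδ, hd⟩ : ∃ δ > 0, ∀ v ∈ f '' S, δ ≤ ‖l - v‖ := by
    simp only [Metric.mem_closure_iff, not_forall, not_exists, not_and, not_lt] at hl
    obtain ⟨δ, hδ, h⟩ := hl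
    exact ⟨δ, hδ, fun v hv => by simpa [dist_eq_norm] using h v hv⟩
  -- Sup-norm error `δ / 3` gives operator error `2δ / 3`, still below `δ`.
  obtain ⟨s, hs, hsv⟩ := exists_simpleFunc_approx hS hne hf hb (ε := δ / 3) (by positivity)
  have hv : ∀ v : s.range, δ ≤ ‖l - v‖ := by
    rintro ⟨v, hv⟩
    obtain ⟨z, rfl⟩ := SimpleFunc.mem_range.1 hv
    exact hd _ (hsv z)
  set g : s.range → ℂ := fun v => (l - v)⁻¹ with hg
  have hg0 : ∀ v : s.range, l - (v : ℂ) ≠ 0 := fun v => norm_pos_iff.1 (hδ.trans_le (hv v))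
  have hT : algebraMap ℂ (H →L[ℂ] H) l - E.simpleIntegral s
      = E.simpleCalculus s (fun v => l - v) := by
    have : (fun v : s.range => l - (v : ℂ)) = algebraMap ℂ _ l - Subtype.val := rfl
    rw [this, map_sub, AlgHomClass.commutes]; rfl
  have h1 : E.simpleCalculus s g * E.simpleCalculus s (fun v => l - v) = 1 := by
    rw [← map_mul, ← map_one (E.simpleCalculus s)]
    congr 1; ext v; exact inv_mul_cancel₀ (hg0 v)
  have h2 : E.simpleCalculus s (fun v => l - v) * E.simpleCalculus s g = 1 := by
    rw [← map_mul, ← map_one (E.simpleCalculus s)]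
    congr 1; ext v; exact mul_inv_cancel₀ (hg0 v)
  have hn : ‖E.simpleCalculus s g‖ ≤ δ⁻¹ := by
    refine (NonUnitalStarAlgHom.norm_apply_le (E.simpleCalculus s) g).trans ?_
    refine (pi_norm_le_iff_of_nonneg (by positivity)).2 fun v => ?_
    rw [hg, norm_inv]
    exact inv_anti₀ hδ (hv v)
  have hAT := E.norm_sub_simpleIntegral_le hS hES hf hb hA (by positivity) hs
  have e : algebraMap ℂ (H →L[ℂ] H) l - A
      = E.simpleCalculus s (fun v => l - v) *
        (1 - E.simpleCalculus s g * (A - E.simpleIntegral s)) := by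
    rw [mul_sub, ← mul_assoc, h2, ← hT]; noncomm_ring
  rw [e]
  refine IsUnit.mul ⟨⟨_, _, h2, h1⟩, rfl⟩ (isUnit_one_sub_of_norm_lt_one ?_)
  calc _ ≤ δ⁻¹ * (2 * (δ / 3)) := (norm_mul_le _ _).trans (by gcongr)
    _ < 1 := by field_simp; norm_num

theorem simpleIntegral_apply_of_proj_fiber (s : SimpleFunc ℂ ℂ) (v : ℂ) (x : H) :
    E.simpleIntegral s (E.proj (s ⁻¹' {v}) x) = v • E.proj (s ⁻¹' {v}) x := by
  have : E.simpleIntegral s * E.proj (s ⁻¹' {v}) = v • E.proj (s ⁻¹' {v}) := by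
    rw [simpleIntegral, simpleCalculus_apply,
      Finset.sum_coe_sort s.range (fun v => v • E.proj (s ⁻¹' {v})), Finset.sum_mul]
    simp_rw [smul_mul_assoc, E.proj_fiber_mul_proj_fiber]
    simp only [smul_ite, smul_zero, Finset.sum_ite_eq', ite_eq_left_iff]
    intro hv
    rw [SimpleFunc.preimage_eq_empty_iff _ _ |>.2 (by simpa using hv), E.proj_empty, smul_zero]
  exact congrArg (fun L : H →L[ℂ] H => L x) this

/-- Near `w` the function `f` is almost constant, so a vector in the range of `E` on a small ball,
cut down to one fibre of a simple approximation, is an approximate eigenvector for `f w`. This rules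
out a bounded inverse. -/
theorem mem_spectrum_of_mem {S : Set ℂ} (hS : IsClosed S)
    (hES : E.proj Sᶜ = 0) (hsupp : ∀ z ∈ S, ∀ r > 0, E.proj (Metric.ball z r) ≠ 0)
    {f : ℂ → ℂ} (hf : ContinuousOn f S) (hb : Bornology.IsBounded (f '' S))
    {A : H →L[ℂ] H} (hA : ∀ x, inner ℂ x (A x) = ∫ z, f z ∂(E.scalarMeasure x)) {w : ℂ}
    (hw : w ∈ S) : f w ∈ spectrum ℂ A := by
  rw [spectrum.mem_iff]
  intro hu
  obtain ⟨R, -, hR⟩ := isUnit_iff_exists.1 hu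
  obtain ⟨ε, hε, hεR⟩ : ∃ ε > 0, ‖R‖ * (4 * ε) < 1 := by
    refine ⟨(‖R‖ * 4 + 1)⁻¹, by positivity, ?_⟩
    rw [← mul_assoc, ← div_eq_mul_inv, div_lt_one (by positivity)]
    linarith
  obtain ⟨r, hr, hwr⟩ := Metric.continuousWithinAt_iff.1 (hf w hw) ε hε
  obtain ⟨s, hs, -⟩ := exists_simpleFunc_approx hS ⟨w, hw⟩ hf hb hε
  have hball : MeasurableSet (Metric.ball w r) := Metric.isOpen_ball.measurableSet
  obtain ⟨v, hv⟩ : ∃ v, E.proj (s ⁻¹' {v} ∩ Metric.ball w r) ≠ 0 := by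
    by_contra! h
    refine hsupp w hw r hr ?_
    rw [← one_mul (E.proj (Metric.ball w r)), ← E.sum_proj_fiber s, Finset.sum_mul]
    refine Finset.sum_eq_zero fun v _ => ?_
    rw [← E.proj_inter _ _ (s.measurableSet_fiber v) hball, h v]
  have hB := (s.measurableSet_fiber v).inter hball
  -- Otherwise the chosen piece of the ball would miss `S`, where `E` lives, and its projection
  -- would vanish.
  have hvw : ‖v - f w‖ ≤ 2 * ε := by
    by_contra hcon
    refine hv (E.proj_mono_zero hB hS.measurableSet.compl (fun z hz hzS => hcon ?_) hES)
    have h1 := hs z hzS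
    have h2 := hwr hzS hz.2
    rw [dist_eq_norm] at h2
    have h3 : s z = v := hz.1
    rw [h3] at h1
    calc ‖v - f w‖ = ‖(f z - f w) - (f z - v)‖ := by congr 1; ring
      _ ≤ _ := norm_sub_le _ _
      _ ≤ 2 * ε := by linarith
  obtain ⟨y, hy⟩ : ∃ y, E.proj (s ⁻¹' {v} ∩ Metric.ball w r) y ≠ 0 := by
    by_contra! h
    exact hv (ContinuousLinearMap.ext h)
  set x := E.proj (s ⁻¹' {v} ∩ Metric.ball w r) y with hx
  have hx1 : E.proj (s ⁻¹' {v}) x = x := by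
    rw [hx, E.proj_proj_apply _ (s.measurableSet_fiber v) hB]
    congr 2
    rw [← inter_assoc, inter_self]
  have hTx : E.simpleIntegral s x = v • x := by
    rw [← hx1, E.simpleIntegral_apply_of_proj_fiber, hx1]
  have hAT := E.norm_sub_simpleIntegral_le hS hES hf hb hA hε.le hs
  have hnx : 0 < ‖x‖ := norm_pos_iff.2 hy
  have hle : ‖(algebraMap ℂ (H →L[ℂ] H) (f w) - A) x‖ ≤ 4 * ε * ‖x‖ := by
    have : (algebraMap ℂ (H →L[ℂ] H) (f w) - A) x
        = -((A - E.simpleIntegral s) x) - (v - f w) • x := by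
      simp only [_root_.sub_apply, hTx, sub_smul,
        Algebra.algebraMap_eq_smul_one, _root_.smul_apply, one_apply_eq_self]
      abel
    rw [this]
    refine (norm_sub_le _ _).trans ?_
    rw [norm_neg, norm_smul]
    have h1 := (A - E.simpleIntegral s).le_of_opNorm_le hAT x
    nlinarith
  have hxe : x = R ((algebraMap ℂ (H →L[ℂ] H) (f w) - A) x) := by
    rw [← mul_apply_eq_comp, hR]; rfl
  have h1 := R.le_opNorm ((algebraMap ℂ (H →L[ℂ] H) (f w) - A) x)
  rw [← hxe] at h1
  have h2 : ‖R‖ * ‖(algebraMap ℂ (H →L[ℂ] H) (f w) - A) x‖ ≤ ‖R‖ * (4 * ε * ‖x‖) := by gcongr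
  nlinarith

theorem spectrum_eq_closure {S : Set ℂ} (hS : IsClosed S) (hne : S.Nonempty)
    (hES : E.proj Sᶜ = 0) (hsupp : ∀ z ∈ S, ∀ r > 0, E.proj (Metric.ball z r) ≠ 0)
    {f : ℂ → ℂ} (hf : ContinuousOn f S) (hb : Bornology.IsBounded (f '' S))
    {A : H →L[ℂ] H} (hA : ∀ x, inner ℂ x (A x) = ∫ z, f z ∂(E.scalarMeasure x)) :
    spectrum ℂ A = closure (f '' S) := by
  refine Subset.antisymm (fun l hl => ?_) (closure_minimal ?_ (spectrum.isClosed A))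
  · by_contra h
    exact spectrum.mem_iff.1 hl (E.isUnit_sub_of_notMem_closure hS hne hES hf hb hA h)
  · rintro _ ⟨w, hw, rfl⟩
    exact E.mem_spectrum_of_mem hS hES hsupp hf hb hA hw

end ProjectionValuedMeasure

/-! ### Locating the support of an arbitrary spectral measure of `N`. -/

namespace ProjectionValuedMeasure

variable {H : Type*} [NormedAddCommGroup H] [InnerProductSpace ℂ H] [CompleteSpace H]
  {E : ProjectionValuedMeasure H} {N : H →ₗ.[ℂ] H}

theorem IsSpectralMeasureOf.integrable_id (hN : E.IsSpectralMeasureOf N) (x : N.domain) :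
    Integrable (fun z => z) (E.scalarMeasure (x : H)) := by
  have h := (hN.1 x).1 x.2
  have : MemLp (fun z : ℂ => z) 2 (E.scalarMeasure (x : H)) := by
    refine ⟨by fun_prop, ?_⟩
    rw [eLpNorm_lt_top_iff_lintegral_rpow_enorm_lt_top (by norm_num) (by norm_num)]
    simpa using h
  exact this.integrable (by norm_num)

theorem IsSpectralMeasureOf.proj_mem_domain_of_isBounded (hN : E.IsSpectralMeasureOf N) (x : H)
    {B : Set ℂ} (hB : MeasurableSet B) (hb : Bornology.IsBounded B) :
    E.proj B x ∈ N.domain := by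
  obtain ⟨C, hC⟩ := hb.exists_norm_le
  rw [hN.1, E.scalarMeasure_proj x hB]
  calc ∫⁻ z in B, ‖z‖ₑ ^ 2 ∂(E.scalarMeasure x)
      ≤ ∫⁻ z in B, ENNReal.ofReal C ^ 2 ∂(E.scalarMeasure x) := by
        refine setLIntegral_mono measurable_const fun z hz => ?_
        gcongr
        rw [← ofReal_norm]
        exact ENNReal.ofReal_le_ofReal (hC z hz)
    _ < ∞ := by
        rw [setLIntegral_const]
        exact ENNReal.mul_lt_top (by simp) (measure_lt_top _ _)

theorem IsSpectralMeasureOf.proj_mem_domain (hN : E.IsSpectralMeasureOf N) {x : H}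
    (hx : x ∈ N.domain) {B : Set ℂ} (hB : MeasurableSet B) : E.proj B x ∈ N.domain := by
  rw [hN.1, E.scalarMeasure_proj x hB]
  exact (setLIntegral_le_lintegral _ _).trans_lt ((hN.1 x).1 hx)

/-- Applied to `E.proj B x`, the hypothesis on `N` says that `Re z - c` has integral zero over `B`;
with constant sign there, it forces `B` to be null. Boundedness of `B` puts `E.proj B x` in the
domain, and the sign of `σ` selects the side of the line. -/
theorem IsSpectralMeasureOf.proj_eq_zero_of_re (hN : E.IsSpectralMeasureOf N) {c : ℝ}
    (hre : ∀ x : N.domain, (inner ℂ (x : H) (N x)).re = c * ‖(x : H)‖ ^ 2) {B : Set ℂ}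
    (hB : MeasurableSet B) (hb : Bornology.IsBounded B) {σ : ℝ}
    (hσ : ∀ z ∈ B, 0 < σ * (z.re - c)) : E.proj B = 0 := by
  refine (E.proj_eq_zero_iff hB).2 fun x => ?_
  have hy := hN.proj_mem_domain_of_isBounded x hB hb
  have hi := hN.integrable_id ⟨_, hy⟩
  have h1 := hre ⟨_, hy⟩
  rw [hN.2] at h1
  simp only [E.scalarMeasure_proj x hB] at hi h1
  have hire : Integrable (fun z : ℂ => z.re) ((E.scalarMeasure x).restrict B) := hi.re
  have h2 : ∫ z in B, σ * (z.re - c) ∂(E.scalarMeasure x) = 0 := by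
    rw [integral_const_mul, integral_sub hire (integrable_const _), integral_const]
    have : ∫ z in B, z.re ∂(E.scalarMeasure x) = (∫ z in B, z ∂(E.scalarMeasure x)).re :=
      integral_re hi
    rw [this, h1, measureReal_restrict_apply_univ, E.scalarMeasure_real_apply x hB, smul_eq_mul]
    ring
  rw [setIntegral_eq_zero_iff_of_nonneg_ae] at h2
  · rw [← Measure.restrict_apply_univ, ← measure_empty (μ := (E.scalarMeasure x).restrict B)]
    refine measure_congr ?_
    filter_upwards [h2, ae_restrict_mem hB] with z hz hzB
    exact absurd hz (hσ z hzB).ne'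
  · exact (ae_restrict_mem hB).mono fun z hz => (hσ z hz).le
  · exact (hire.sub (integrable_const c)).const_mul σ

theorem proj_iUnion_eq_zero {B : ℕ → Set ℂ} (hB : ∀ n, MeasurableSet (B n))
    (h : ∀ n, E.proj (B n) = 0) : E.proj (⋃ n, B n) = 0 :=
  (E.proj_eq_zero_iff (.iUnion hB)).2 fun x =>
    measure_iUnion_null fun n => (E.proj_eq_zero_iff (hB n)).1 (h n) x

theorem IsSpectralMeasureOf.proj_compl_verticalLine (hN : E.IsSpectralMeasureOf N) {c : ℝ}
    (hre : ∀ x : N.domain, (inner ℂ (x : H) (N x)).re = c * ‖(x : H)‖ ^ 2) :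
    E.proj {z | z.re = c}ᶜ = 0 := by
  have hm : ∀ σ : ℝ, MeasurableSet {z : ℂ | 0 < σ * (z.re - c)} := fun σ =>
    measurableSet_lt measurable_const (by fun_prop)
  have h : ∀ (σ : ℝ) (n : ℕ), E.proj ({z | 0 < σ * (z.re - c)} ∩ Metric.ball 0 n) = 0 :=
    fun σ n => hN.proj_eq_zero_of_re hre ((hm σ).inter Metric.isOpen_ball.measurableSet)
      (Metric.isBounded_ball.subset inter_subset_right) (σ := σ) fun z hz => hz.1
  have hU : ∀ σ : ℝ, E.proj (⋃ n : ℕ, {z | 0 < σ * (z.re - c)} ∩ Metric.ball 0 n) = 0 := fun σ =>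
    proj_iUnion_eq_zero (fun n => (hm σ).inter Metric.isOpen_ball.measurableSet) (h σ)
  have hU' : ∀ σ : ℝ, ∀ x, E.scalarMeasure x {z | 0 < σ * (z.re - c)} = 0 := fun σ => by
    have := hU σ
    rw [← inter_iUnion, Metric.iUnion_ball_nat, inter_univ] at this
    exact (E.proj_eq_zero_iff (hm σ)).1 this
  have hl : MeasurableSet {z : ℂ | z.re = c} :=
    measurableSet_eq_fun Complex.measurable_re measurable_const
  refine (E.proj_eq_zero_iff hl.compl).2 fun x =>
    measure_mono_null (fun z hz => ?_) (measure_union_null (hU' 1 x) (hU' (-1) x))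
  rcases lt_or_gt_of_ne (show z.re ≠ c from hz) with h | h
  · right; simp only [mem_ofPred_eq]; linarith
  · left; simp only [mem_ofPred_eq]; linarith

/-- Spectrally separated vectors produce no cross terms, so the measure depends on `a` only through
its modulus. -/
theorem scalarMeasure_add_smul {B : Set ℂ} (hB : MeasurableSet B) {p q : H}
    (hp : E.proj B p = p) (hq : E.proj Bᶜ q = q) (a : ℂ) :
    E.scalarMeasure (p + a • q)
      = E.scalarMeasure p + ENNReal.ofReal (‖a‖ ^ 2) • E.scalarMeasure q := by
  have h1 : E.proj B q = 0 := by
    rw [← hq, E.proj_proj_apply _ hB hB.compl, inter_compl_self, E.proj_empty]; rfl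
  have h2 : E.proj Bᶜ p = 0 := by
    rw [← hp, E.proj_proj_apply _ hB.compl hB, compl_inter_self, E.proj_empty]; rfl
  conv_lhs => rw [← Measure.restrict_add_restrict_compl hB (μ := E.scalarMeasure (p + a • q))]
  rw [← E.scalarMeasure_proj _ hB, ← E.scalarMeasure_proj _ hB.compl]
  simp [hp, hq, h1, h2, E.scalarMeasure_smul]

/-- The quadratic form of `N` at `p + a • q` is the same for every `a` of modulus one; comparing `a
= 1` with `a = I` kills both cross terms. This stands in for commutation of `N` with `E.proj B`. -/
theorem IsSpectralMeasureOf.inner_eq_zero (hN : E.IsSpectralMeasureOf N) {B : Set ℂ}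
    (hB : MeasurableSet B) {p q : N.domain} (hp : E.proj B p = (p : H))
    (hq : E.proj Bᶜ q = (q : H)) :
    inner ℂ (p : H) (N q) = 0 ∧ inner ℂ (q : H) (N p) = 0 := by
  have key : ∀ a : ℂ, ‖a‖ = 1 →
      a * inner ℂ (p : H) (N q) + (starRingEnd ℂ) a * inner ℂ (q : H) (N p) = 0 := by
    intro a ha
    have h := hN.2 (p + a • q)
    rw [Submodule.coe_add, Submodule.coe_smul, E.scalarMeasure_add_smul hB hp hq, ha, one_pow,
      ENNReal.ofReal_one, one_smul, integral_add_measure (hN.integrable_id p) (hN.integrable_id q),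
      ← hN.2, ← hN.2, LinearPMap.map_add, LinearPMap.map_smul] at h
    simp only [inner_add_left, inner_add_right, inner_smul_left, inner_smul_right] at h
    have hc : (starRingEnd ℂ) a * a = 1 := by
      rw [mul_comm, Complex.mul_conj, Complex.normSq_eq_norm_sq, ha]; simp
    linear_combination h - inner ℂ (q : H) (N q) * hc
  have h1 := key 1 (by simp)
  have h2 := key Complex.I (by simp)
  simp only [map_one, one_mul, Complex.conj_I] at h1 h2
  have h3 : inner ℂ (p : H) (N q) - inner ℂ (q : H) (N p) = 0 := by
    linear_combination -Complex.I * h2 + (inner ℂ (p : H) (N q) - inner ℂ (q : H) (N p))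
      * Complex.I_sq
  constructor
  · linear_combination (h1 + h3) / 2
  · linear_combination (h1 - h3) / 2

/-- On the line, `z - z₀` is `i (Im z - Im z₀)`. Testing `N x - z₀ x` against `p - q`, where `p` and
`q` are the parts of `x` above and below `z₀`, inserts the sign of `Im z - Im z₀` and yields `∫ |Im
z - Im z₀| dE_{x,x} ≥ r ‖x‖²`; Cauchy-Schwarz finishes, as `‖p - q‖ = ‖x‖`. -/
theorem IsSpectralMeasureOf.mul_norm_le (hN : E.IsSpectralMeasureOf N) {z₀ : ℂ}
    (hline : E.proj {z | z.re = z₀.re}ᶜ = 0) {r : ℝ} (h0 : E.proj (Metric.ball z₀ r) = 0)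
    (x : N.domain) : r * ‖(x : H)‖ ≤ ‖N x - z₀ • (x : H)‖ := by
  set B : Set ℂ := {z | z₀.im ≤ z.im} with hBdef
  have hB : MeasurableSet B := measurableSet_le measurable_const Complex.measurable_im
  set p : N.domain := ⟨E.proj B x, hN.proj_mem_domain x.2 hB⟩ with hpdef
  set q : N.domain := ⟨E.proj Bᶜ x, hN.proj_mem_domain x.2 hB.compl⟩ with hqdef
  have hp : E.proj B p = (p : H) := by
    rw [hpdef]; dsimp only; rw [E.proj_proj_apply _ hB hB, inter_self]
  have hq : E.proj Bᶜ q = (q : H) := by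
    rw [hqdef]; dsimp only; rw [E.proj_proj_apply _ hB.compl hB.compl, inter_self]
  have hx : x = p + q := Subtype.ext (E.proj_add_proj_compl x hB).symm
  have hpq : inner ℂ (p : H) (q : H) = 0 := by
    rw [← hp, E.inner_proj_left _ _ hB, ← hq, E.proj_proj_apply _ hB hB.compl, inter_compl_self,
      E.proj_empty]
    simp
  have hpq' : inner ℂ (p : H) (-(q : H)) = 0 := by rw [inner_neg_right, hpq, neg_zero]
  have hqp : inner ℂ (q : H) (p : H) = 0 := by rw [← inner_conj_symm, hpq, map_zero]
  obtain ⟨c1, c2⟩ := hN.inner_eq_zero hB hp hq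
  have hnorm : ‖(p : H) - q‖ = ‖(x : H)‖ := by
    have : ‖(p : H) - q‖ * ‖(p : H) - q‖ = ‖(x : H)‖ * ‖(x : H)‖ := by
      rw [hx, Submodule.coe_add, norm_add_sq_eq_norm_sq_add_norm_sq_of_inner_eq_zero _ _ hpq,
        sub_eq_add_neg, norm_add_sq_eq_norm_sq_add_norm_sq_of_inner_eq_zero _ _ hpq', norm_neg]
    exact (mul_self_inj (norm_nonneg _) (norm_nonneg _)).1 this
  have hexp : inner ℂ ((p : H) - q) (N x - z₀ • (x : H))
      = (inner ℂ (p : H) (N p) - z₀ * inner ℂ (p : H) p)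
        - (inner ℂ (q : H) (N q) - z₀ * inner ℂ (q : H) q) := by
    rw [hx, LinearPMap.map_add, Submodule.coe_add]
    simp only [inner_sub_left, inner_sub_right, inner_add_right, inner_smul_right, c1, c2,
      hpq, hqp]
    ring
  set μ := E.scalarMeasure (x : H) with hμ
  have hae : ∀ᵐ z ∂μ, r ≤ |z.im - z₀.im| := by
    have h1 := E.ae_mem_of_proj_compl (measurableSet_eq_fun Complex.measurable_re measurable_const)
      hline (x : H)
    have h2 : ∀ᵐ z ∂μ, z ∉ Metric.ball z₀ r :=
      (measure_eq_zero_iff_ae_notMem).1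
        ((E.proj_eq_zero_iff Metric.isOpen_ball.measurableSet).1 h0 x)
    filter_upwards [h1, h2] with z hz1 hz2
    rw [Metric.mem_ball, not_lt, Complex.dist_of_re_eq hz1, Real.dist_eq] at hz2
    exact hz2
  have hi := hN.integrable_id x
  have him : Integrable (fun z : ℂ => z.im) μ := hi.im
  have part : ∀ {C : Set ℂ} (hC : MeasurableSet C),
      (inner ℂ (E.proj C x) (N ⟨E.proj C x, hN.proj_mem_domain x.2 hC⟩)
        - z₀ * inner ℂ (E.proj C x) (E.proj C x)).im = ∫ z in C, (z.im - z₀.im) ∂μ := by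
    intro C hC
    have e := hN.2 ⟨E.proj C x, hN.proj_mem_domain x.2 hC⟩
    dsimp only at e
    rw [e, E.scalarMeasure_proj _ hC, integral_sub him.restrict (integrable_const _),
      integral_const, measureReal_restrict_apply_univ, E.scalarMeasure_real_apply _ hC,
      inner_self_eq_norm_sq_to_K, Complex.sub_im]
    congr 1
    · exact (integral_im hi.restrict).symm
    · simp [← Complex.ofReal_pow, mul_comm]
  have hint : r * ‖(x : H)‖ ^ 2 ≤ (inner ℂ ((p : H) - q) (N x - z₀ • (x : H))).im := by
    rw [hexp, Complex.sub_im, part hB, part hB.compl, ← E.scalarMeasure_real_univ (x : H)]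
    have hj : Integrable (fun z : ℂ => z.im - z₀.im) μ := him.sub (integrable_const _)
    have e1 : ∫ z in B, (z.im - z₀.im) ∂μ = ∫ z in B, |z.im - z₀.im| ∂μ :=
      setIntegral_congr_fun hB fun z hz => (abs_of_nonneg (sub_nonneg.2 hz)).symm
    have e2 : ∫ z in Bᶜ, (z.im - z₀.im) ∂μ = -∫ z in Bᶜ, |z.im - z₀.im| ∂μ := by
      rw [← integral_neg]
      exact setIntegral_congr_fun hB.compl fun z hz => by
        have : z.im < z₀.im := not_le.1 hz
        rw [abs_of_neg (sub_neg.2 this), neg_neg]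
    rw [e1, e2, sub_neg_eq_add, integral_add_compl hB hj.abs]
    calc r * μ.real univ = ∫ _, r ∂μ := by rw [integral_const, smul_eq_mul, mul_comm]
      _ ≤ _ := integral_mono_ae (integrable_const _) hj.abs hae
  have hcs : (inner ℂ ((p : H) - q) (N x - z₀ • (x : H))).im
      ≤ ‖(x : H)‖ * ‖N x - z₀ • (x : H)‖ := by
    rw [← hnorm]
    exact (Complex.abs_im_le_norm _ |> (le_abs_self _).trans).trans (norm_inner_le_norm _ _)
  rcases eq_or_ne (x : H) 0 with h | h
  · rw [h]; simp
  · have hpos : 0 < ‖(x : H)‖ := norm_pos_iff.2 h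
    have : ‖(x : H)‖ * (r * ‖(x : H)‖) ≤ ‖(x : H)‖ * ‖N x - z₀ • (x : H)‖ := by nlinarith
    exact le_of_mul_le_mul_left this hpos

end ProjectionValuedMeasure

/-! ### Multiplication operators on `L²` and their spectral measures. -/

theorem hasSum_of_hasSum_norm_sq {H : Type*} [NormedAddCommGroup H] [InnerProductSpace ℂ H]
    {v : ℕ → H} {w : H} (hv : Pairwise fun i j => inner ℂ (v i) (v j) = 0)
    (hvw : ∀ i, inner ℂ w (v i) = ((‖v i‖ ^ 2 : ℝ) : ℂ))
    (h : HasSum (fun i => ‖v i‖ ^ 2) (‖w‖ ^ 2)) : HasSum v w := by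
  have key : ∀ s : Finset ℕ, ‖w - ∑ i ∈ s, v i‖ ^ 2 = ‖w‖ ^ 2 - ∑ i ∈ s, ‖v i‖ ^ 2 := by
    intro s
    have h1 : inner ℂ w (∑ i ∈ s, v i) = ((∑ i ∈ s, ‖v i‖ ^ 2 : ℝ) : ℂ) := by
      rw [inner_sum, Complex.ofReal_sum]
      exact Finset.sum_congr rfl fun i _ => hvw i
    have h2 : inner ℂ (∑ i ∈ s, v i) (∑ i ∈ s, v i) = ((∑ i ∈ s, ‖v i‖ ^ 2 : ℝ) : ℂ) := by
      rw [sum_inner, Complex.ofReal_sum]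
      refine Finset.sum_congr rfl fun i hi => ?_
      rw [inner_sum, Finset.sum_eq_single_of_mem i hi fun j _ hj => hv hj.symm,
        inner_self_eq_norm_sq_to_K]
      simp
    have h3 : ‖∑ i ∈ s, v i‖ ^ 2 = ∑ i ∈ s, ‖v i‖ ^ 2 := by
      rw [← inner_self_eq_norm_sq (𝕜 := ℂ), h2]; exact Complex.ofReal_re _
    rw [norm_sub_sq (𝕜 := ℂ), h3, h1]
    simp only [RCLike.re_to_complex, Complex.ofReal_re]
    ring
  have hs : Filter.Tendsto (fun s : Finset ℕ => ‖w - ∑ i ∈ s, v i‖ ^ 2) Filter.atTop (nhds 0) := by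
    simp_rw [key]
    rw [← sub_self (‖w‖ ^ 2)]
    exact tendsto_const_nhds.sub h
  have hn : Filter.Tendsto (fun s : Finset ℕ => ‖w - ∑ i ∈ s, v i‖) Filter.atTop (nhds 0) := by
    have := (Real.continuous_sqrt.tendsto 0).comp hs
    simpa [Function.comp_def, Real.sqrt_sq] using this
  rw [HasSum]
  refine tendsto_iff_norm_sub_tendsto_zero.2 ?_
  simpa only [SummationFilter.unconditional_filter, norm_sub_rev] using hn

section Multiplication

variable {α : Type*} [MeasurableSpace α] {μ : Measure α}

open Classical in
/-- Multiplication by an essentially bounded function `m` on `L²` (zero for other `m`). -/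
noncomputable def mulL2 (μ : Measure α) (m : α → ℂ) : Lp ℂ 2 μ →L[ℂ] Lp ℂ 2 μ :=
  if h : MemLp m ∞ μ then (ContinuousLinearMap.mul ℂ ℂ).holderL μ ∞ 2 2 (h.toLp m) else 0

theorem coeFn_mulL2 {m : α → ℂ} (h : MemLp m ∞ μ) (u : Lp ℂ 2 μ) :
    mulL2 μ m u =ᵐ[μ] fun a => m a * u a := by
  rw [mulL2, dif_pos h]
  have h1 := (ContinuousLinearMap.mul ℂ ℂ).coeFn_holder (r := 2) (h.toLp m) u
  filter_upwards [h1, h.coeFn_toLp] with a ha hb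
  rw [← hb]; exact ha

theorem inner_mulL2_left {m : α → ℂ} (h : MemLp m ∞ μ) (u v : Lp ℂ 2 μ) :
    inner ℂ (mulL2 μ m u) v = ∫ a, (starRingEnd ℂ) (m a) * inner ℂ (u a) (v a) ∂μ := by
  rw [L2.inner_def]
  refine integral_congr_ae ?_
  filter_upwards [coeFn_mulL2 h u] with a ha
  rw [ha]; simp; ring

theorem memLp_indicator_one {s : Set α} (hs : MeasurableSet s) :
    MemLp (s.indicator (1 : α → ℂ)) ∞ μ :=
  memLp_top_of_bound ((measurable_one.indicator hs).aestronglyMeasurable) 1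
    (.of_forall fun a => by by_cases h : a ∈ s <;> simp [h])

theorem coeFn_mulL2_indicator {s : Set α} (hs : MeasurableSet s) (u : Lp ℂ 2 μ) :
    mulL2 μ (s.indicator 1) u =ᵐ[μ] s.indicator u := by
  filter_upwards [coeFn_mulL2 (memLp_indicator_one hs) u] with a ha
  rw [ha]
  by_cases h : a ∈ s <;> simp [h]

theorem norm_sq_mulL2_indicator {s : Set α} (hs : MeasurableSet s) (u : Lp ℂ 2 μ) :
    ‖mulL2 μ (s.indicator 1) u‖ ^ 2 = ∫ a in s, ‖u a‖ ^ 2 ∂μ := by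
  rw [← inner_self_eq_norm_sq (𝕜 := ℂ), L2.inner_def, ← integral_re (L2.integrable_inner _ _),
    ← integral_indicator hs]
  refine integral_congr_ae ?_
  filter_upwards [coeFn_mulL2_indicator hs u] with a ha
  rw [ha]
  by_cases h : a ∈ s <;> simp [h, inner_self_eq_norm_sq_to_K, ← Complex.ofReal_pow]

theorem mulL2_indicator_mul {s t : Set α} (hs : MeasurableSet s) (ht : MeasurableSet t) :
    mulL2 μ (s.indicator 1) * mulL2 μ (t.indicator 1) = mulL2 μ ((s ∩ t).indicator 1) := by
  ext1 u
  refine Lp.ext ?_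
  filter_upwards [coeFn_mulL2_indicator hs (mulL2 μ (t.indicator 1) u),
    coeFn_mulL2_indicator ht u, coeFn_mulL2_indicator (hs.inter ht) u] with a h1 h2 h3
  rw [mul_apply_eq_comp, h1, h3]
  by_cases hsa : a ∈ s <;> by_cases hta : a ∈ t <;> simp [hsa, hta, h2]

theorem isStarProjection_mulL2_indicator {s : Set α} (hs : MeasurableSet s) :
    IsStarProjection (mulL2 μ (s.indicator 1)) := by
  refine ⟨by rw [IsIdempotentElem, mulL2_indicator_mul hs hs, inter_self], ?_⟩
  rw [IsSelfAdjoint, ContinuousLinearMap.star_eq_adjoint, eq_comm,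
    ContinuousLinearMap.eq_adjoint_iff]
  intro u v
  rw [← inner_conj_symm u, inner_mulL2_left (memLp_indicator_one hs),
    inner_mulL2_left (memLp_indicator_one hs), ← integral_conj]
  refine integral_congr_ae (.of_forall fun a => ?_)
  by_cases h : a ∈ s <;> simp [h, mul_comm]

theorem mulL2_indicator_empty : mulL2 μ ((∅ : Set α).indicator 1) = 0 := by
  refine ContinuousLinearMap.ext fun u => Lp.ext ?_
  filter_upwards [coeFn_mulL2_indicator (μ := μ) .empty u, Lp.coeFn_zero ℂ 2 μ] with a h1 h2
  rw [h1, indicator_empty]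
  exact h2.symm

theorem hasSum_mulL2_indicator {s : ℕ → Set α} (hs : ∀ n, MeasurableSet (s n))
    (hd : Pairwise (Function.onFun Disjoint s)) (u : Lp ℂ 2 μ) :
    HasSum (fun n => mulL2 μ ((s n).indicator 1) u) (mulL2 μ ((⋃ n, s n).indicator 1) u) := by
  have hinner : ∀ {A B : Set α}, MeasurableSet A → MeasurableSet B →
      inner ℂ (mulL2 μ (A.indicator 1) u) (mulL2 μ (B.indicator 1) u)
        = inner ℂ u (mulL2 μ ((A ∩ B).indicator 1) u) := by
    intro A B hA hB
    rw [← mulL2_indicator_mul hA hB, mul_apply_eq_comp, ← ContinuousLinearMap.adjoint_inner_right,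
      ← ContinuousLinearMap.star_eq_adjoint,
      (isStarProjection_mulL2_indicator hA).isSelfAdjoint.star_eq]
  refine hasSum_of_hasSum_norm_sq (fun i j hij => ?_) (fun i => ?_) ?_
  · dsimp only
    rw [hinner (hs i) (hs j), disjoint_iff_inter_eq_empty.1 (hd hij)]
    rw [mulL2_indicator_empty]
    exact inner_zero_right _
  · rw [hinner (.iUnion hs) (hs i), inter_eq_self_of_subset_right (subset_iUnion s i),
      ← inter_self (s i), ← hinner (hs i) (hs i), inner_self_eq_norm_sq_to_K, inter_self]
    simp
  · simp_rw [norm_sq_mulL2_indicator (hs _), norm_sq_mulL2_indicator (.iUnion hs)]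
    exact hasSum_integral_iUnion hs hd ((Lp.memLp u).integrable_norm_pow (by norm_num)).integrableOn

variable {H : Type*} [NormedAddCommGroup H] [InnerProductSpace ℂ H] [CompleteSpace H]

/-- The spectral measure of the operator which a unitary `W` onto `L²` turns into multiplication
by `l`. -/
noncomputable def multiplicationPVM (W : H ≃ₗᵢ[ℂ] Lp ℂ 2 μ) {l : α → ℂ} (hl : Measurable l) :
    ProjectionValuedMeasure H where
  proj B := W.symm.conjStarAlgEquiv (mulL2 μ ((l ⁻¹' B).indicator 1))
  isStarProjection B hB := (isStarProjection_mulL2_indicator (hl hB)).map _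
  proj_empty := by
    rw [preimage_empty, mulL2_indicator_empty, map_zero]
  proj_univ := by
    have : mulL2 μ ((univ : Set α).indicator 1) = 1 := by
      ext1 u
      refine Lp.ext ?_
      filter_upwards [coeFn_mulL2_indicator (μ := μ) .univ u] with a h1
      rw [h1]; simp
    rw [preimage_univ, this, map_one]
  proj_inter A B hA hB := by
    rw [preimage_inter, ← mulL2_indicator_mul (hl hA) (hl hB), map_mul]
  hasSum_proj B hB hd x := by
    have h := hasSum_mulL2_indicator (μ := μ) (fun n => hl (hB n))
      (fun i j hij => (hd hij).preimage l) (W x)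
    rw [preimage_iUnion]
    exact h.mapL (W.symm.toContinuousLinearEquiv : Lp ℂ 2 μ →L[ℂ] H)

theorem scalarMeasure_multiplicationPVM (W : H ≃ₗᵢ[ℂ] Lp ℂ 2 μ) {l : α → ℂ} (hl : Measurable l)
    (x : H) : (multiplicationPVM W hl).scalarMeasure x
      = (μ.withDensity fun a => ENNReal.ofReal (‖W x a‖ ^ 2)).map l := by
  ext B hB
  rw [ProjectionValuedMeasure.scalarMeasure_apply _ _ hB, Measure.map_apply hl hB,
    withDensity_apply _ (hl hB)]
  have : (multiplicationPVM W hl).proj B x = W.symm (mulL2 μ ((l ⁻¹' B).indicator 1) (W x)) := rfl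
  rw [this, LinearIsometryEquiv.norm_map, norm_sq_mulL2_indicator (hl hB),
    ofReal_integral_eq_lintegral_ofReal]
  · exact ((Lp.memLp (W x)).integrable_norm_pow (by norm_num)).integrableOn
  · exact .of_forall fun a => by positivity

/-- For a measurable embedding the change of variables needs no regularity of `f` off the range of
`l`; cut-off functions are controlled only on the line. -/
theorem isIntegral_multiplicationPVM (W : H ≃ₗᵢ[ℂ] Lp ℂ 2 μ) {l : α → ℂ}
    (hl : MeasurableEmbedding l) {f : ℂ → ℂ} (hf : AEStronglyMeasurable (f ∘ l) μ) {A : H →ₗ.[ℂ] H}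
    (hA : ∀ x y, (x, y) ∈ A.graph ↔ W y =ᵐ[μ] fun a => f (l a) * W x a) :
    (multiplicationPVM W hl.measurable).IsIntegral f A := by
  have hmeas : ∀ x, Measurable fun a => ENNReal.ofReal (‖W x a‖ ^ 2) := fun x => by
    have := (Lp.stronglyMeasurable (W x)).measurable
    fun_prop
  have hfin : ∀ x, ∀ᵐ a ∂μ, ENNReal.ofReal (‖W x a‖ ^ 2) < ∞ :=
    fun x => .of_forall fun a => by simp
  constructor
  · intro x
    rw [scalarMeasure_multiplicationPVM, hl.lintegral_map,
      lintegral_withDensity_eq_lintegral_mul_non_measurable _ (hmeas x) (hfin x)]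
    have e : ∀ a, ((fun a => ENNReal.ofReal (‖W x a‖ ^ 2)) * fun a => ‖f (l a)‖ₑ ^ 2) a
        = ‖f (l a) * W x a‖ₑ ^ 2 := fun a => by
      rw [Pi.mul_apply, enorm_mul, mul_pow, mul_comm, ENNReal.ofReal_pow (norm_nonneg _),
        ofReal_norm]
    simp_rw [e]
    have hm : AEStronglyMeasurable (fun a => f (l a) * W x a) μ :=
      hf.mul (Lp.aestronglyMeasurable _)
    have hmem : (∫⁻ a, ‖f (l a) * W x a‖ₑ ^ 2 ∂μ < ∞) ↔ MemLp (fun a => f (l a) * W x a) 2 μ := by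
      rw [MemLp, and_iff_right hm,
        eLpNorm_lt_top_iff_lintegral_rpow_enorm_lt_top (by norm_num) (by norm_num)]
      simp
    rw [hmem, LinearPMap.mem_domain_iff]
    constructor
    · rintro ⟨y, hy⟩
      exact (memLp_congr_ae ((hA x y).1 hy)).1 (Lp.memLp _)
    · intro h
      refine ⟨W.symm (h.toLp _), (hA _ _).2 ?_⟩
      rw [LinearIsometryEquiv.apply_symm_apply]
      exact h.coeFn_toLp
  · intro x
    rw [scalarMeasure_multiplicationPVM, hl.integral_map,
      integral_withDensity_eq_integral_toReal_smul (hmeas x) (hfin x), ← W.inner_map_map,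
      L2.inner_def]
    refine integral_congr_ae ?_
    filter_upwards [(hA x (A x)).1 (A.mem_graph x)] with a ha
    rw [ha, ENNReal.toReal_ofReal (by positivity), RCLike.inner_apply, Complex.real_smul,
      mul_assoc, Complex.mul_conj, Complex.normSq_eq_norm_sq]
    ring

end Multiplication

/-! ### Removing the weight from `ℍ_c`. -/

theorem weightedMeasure_absolutelyContinuous (c : ℝ) : weightedMeasure c ≪ volume :=
  withDensity_absolutelyContinuous _ _

theorem absolutelyContinuous_weightedMeasure (c : ℝ) : volume ≪ weightedMeasure c :=
  withDensity_absolutelyContinuous' (by fun_prop)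
    (Filter.Eventually.of_forall fun t => by simp [Real.exp_pos])

theorem eLpNorm_weightedMeasure (c : ℝ) (g : ℝ → ℂ) :
    eLpNorm g 2 (weightedMeasure c)
      = eLpNorm (fun t => (Real.exp (-c * t) : ℂ) * g t) 2 volume := by
  rw [eLpNorm_eq_lintegral_rpow_enorm_toReal (by norm_num) (by norm_num),
    eLpNorm_eq_lintegral_rpow_enorm_toReal (by norm_num) (by norm_num), weightedMeasure,
    lintegral_withDensity_eq_lintegral_mul_non_measurable _ (by fun_prop)
      (.of_forall fun t => by simp)]
  congr 1
  refine lintegral_congr fun t => ?_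
  have h : Real.exp (-2 * c * t) = Real.exp (-c * t) ^ 2 := by
    rw [sq, ← Real.exp_add]; ring_nf
  simp only [Pi.mul_apply, enorm_mul, ENNReal.toReal_ofNat, ENNReal.rpow_ofNat, mul_pow, h]
  rw [ENNReal.ofReal_pow (Real.exp_pos _).le, ← ofReal_norm (Real.exp (-c * t) : ℂ),
    Complex.norm_real, Real.norm_of_nonneg (Real.exp_pos _).le]

theorem memLp_weightedMeasure_iff (c : ℝ) (g : ℝ → ℂ) :
    MemLp g 2 (weightedMeasure c) ↔ MemLp (fun t => (Real.exp (-c * t) : ℂ) * g t) 2 volume := by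
  rw [MemLp, MemLp, eLpNorm_weightedMeasure]
  refine and_congr_left fun _ => ⟨fun h => ?_, fun h => ?_⟩
  · exact (Continuous.aestronglyMeasurable (by fun_prop)).mul
      (h.mono_ac (absolutelyContinuous_weightedMeasure c))
  · have h2 : AEStronglyMeasurable (fun t => (Real.exp (c * t) : ℂ) *
        ((Real.exp (-c * t) : ℂ) * g t)) volume :=
      (Continuous.aestronglyMeasurable (by fun_prop)).mul h
    refine (h2.mono_ac (weightedMeasure_absolutelyContinuous c)).congr (.of_forall fun t => ?_)
    dsimp only
    rw [← mul_assoc, ← Complex.ofReal_mul, ← Real.exp_add]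
    simp

theorem exp_neg_mul_exp_mul (c t : ℝ) (z : ℂ) :
    (Real.exp (-c * t) : ℂ) * ((Real.exp (c * t) : ℂ) * z) = z := by
  rw [← mul_assoc, ← Complex.ofReal_mul, ← Real.exp_add]; simp

theorem exp_mul_exp_neg_mul (c t : ℝ) (z : ℂ) :
    (Real.exp (c * t) : ℂ) * ((Real.exp (-c * t) : ℂ) * z) = z := by
  rw [← mul_assoc, ← Complex.ofReal_mul, ← Real.exp_add]; simp

theorem memLp_exp_mul (c : ℝ) {u : ℝ → ℂ} (hu : MemLp u 2 volume) :
    MemLp (fun t => (Real.exp (c * t) : ℂ) * u t) 2 (weightedMeasure c) :=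
  (memLp_weightedMeasure_iff c _).2
    ((memLp_congr_ae (.of_forall fun t => exp_neg_mul_exp_mul c t _)).2 hu)

theorem memLp_exp_neg_mul (c : ℝ) (f : WeightedL2 c) :
    MemLp (fun t => (Real.exp (-c * t) : ℂ) * f t) 2 volume :=
  (memLp_weightedMeasure_iff c f).1 (Lp.memLp f)

/-- The unitary map `f ↦ e^{-ct} f(t)` from `L²(ℝ, e^{-2ct} dt)` onto `L²(ℝ)`. -/
noncomputable def untwist (c : ℝ) : WeightedL2 c ≃ₗᵢ[ℂ] Lp ℂ 2 (volume : Measure ℝ) where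
  toFun f := (memLp_exp_neg_mul c f).toLp _
  invFun u := (memLp_exp_mul c (Lp.memLp u)).toLp _
  map_add' f g := by
    rw [← MemLp.toLp_add, MemLp.toLp_eq_toLp_iff]
    filter_upwards [(ae_weightedMeasure_iff c).1 (Lp.coeFn_add f g)] with t ht
    rw [ht, Pi.add_apply, Pi.add_apply, mul_add]
  map_smul' a f := by
    rw [RingHom.id_apply, ← MemLp.toLp_const_smul, MemLp.toLp_eq_toLp_iff]
    filter_upwards [(ae_weightedMeasure_iff c).1 (Lp.coeFn_smul a f)] with t ht
    rw [ht, Pi.smul_apply, Pi.smul_apply, smul_eq_mul, smul_eq_mul]; ring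
  left_inv f := by
    refine Lp.ext ((ae_weightedMeasure_iff c).2 ?_)
    filter_upwards [(ae_weightedMeasure_iff c).1 (MemLp.coeFn_toLp (memLp_exp_mul c
      (Lp.memLp ((memLp_exp_neg_mul c f).toLp _)))), MemLp.coeFn_toLp (memLp_exp_neg_mul c f)]
      with t h1 h2
    rw [h1, h2, exp_mul_exp_neg_mul]
  right_inv u := by
    refine Lp.ext ?_
    filter_upwards [MemLp.coeFn_toLp (memLp_exp_neg_mul c
      ((memLp_exp_mul c (Lp.memLp u)).toLp _)), (ae_weightedMeasure_iff c).1
      (MemLp.coeFn_toLp (memLp_exp_mul c (Lp.memLp u)))] with t h1 h2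
    rw [h1, h2, exp_neg_mul_exp_mul]
  norm_map' f := by
    change ‖(memLp_exp_neg_mul c f).toLp _‖ = _
    rw [Lp.norm_toLp, Lp.norm_def, eLpNorm_weightedMeasure]

theorem coeFn_untwist (c : ℝ) (f : WeightedL2 c) :
    untwist c f =ᵐ[volume] fun t => (Real.exp (-c * t) : ℂ) * f t :=
  MemLp.coeFn_toLp (memLp_exp_neg_mul c f)

theorem coeFn_untwist_symm (c : ℝ) (u : Lp ℂ 2 (volume : Measure ℝ)) :
    (untwist c).symm u =ᵐ[volume] fun t => (Real.exp (c * t) : ℂ) * u t :=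
  (ae_weightedMeasure_iff c).1 (MemLp.coeFn_toLp (memLp_exp_mul c (Lp.memLp u)))

theorem coeFn_eq_exp_mul_untwist (c : ℝ) (f : WeightedL2 c) :
    f =ᵐ[volume] fun t => (Real.exp (c * t) : ℂ) * untwist c f t := by
  filter_upwards [coeFn_untwist c f] with t ht
  rw [ht, exp_mul_exp_neg_mul]

theorem MeasureTheory.LocallyIntegrable.intervalIntegrable' {E : Type*} [NormedAddCommGroup E]
    {h : ℝ → E} (hh : LocallyIntegrable h volume) (a b : ℝ) :
    IntervalIntegrable h volume a b :=
  (intervalIntegrable_iff' (by simp)).2 (hh.integrableOn_isCompact isCompact_uIcc)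

theorem locallyIntegrable_weightedL2 (c : ℝ) (f : WeightedL2 c) :
    LocallyIntegrable f volume := by
  have h1 : LocallyIntegrable (untwist c f) volume :=
    (Lp.memLp (untwist c f)).locallyIntegrable (by norm_num)
  have h2 : LocallyIntegrable (fun t => (Real.exp (c * t) : ℂ) * untwist c f t) volume :=
    h1.continuous_mul (by fun_prop)
  intro x
  obtain ⟨s, hs, hi⟩ := h2 x
  exact ⟨s, hs, hi.congr_fun_ae (ae_restrict_of_ae (coeFn_eq_exp_mul_untwist c f).symm)⟩

/-! ### The derivative on `ℍ_c`: primitives, closedness, injectivity of `∂ - (c + 1)`. -/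

section AbsolutelyContinuous

theorem AbsolutelyContinuousOnInterval.integral_complex {h : ℝ → ℂ}
    (hh : LocallyIntegrable h volume) (C : ℂ) (a b : ℝ) :
    AbsolutelyContinuousOnInterval (fun t => C + ∫ s in (0 : ℝ)..t, h s) a b := by
  have key : ∀ r : ℝ → ℝ, LocallyIntegrable r volume → ∀ w : ℂ,
      AbsolutelyContinuousOnInterval (fun t => (∫ s in (0 : ℝ)..t, r s) • w) a b := by
    intro r hr w
    -- The interval is enlarged to contain the base point `0` of the primitive.
    have h1 : AbsolutelyContinuousOnInterval (fun t => ∫ s in (0 : ℝ)..t, r s)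
        (min 0 (min a b)) (max 0 (max a b)) :=
      IntervalIntegrable.absolutelyContinuousOnInterval_intervalIntegral
        (hr.intervalIntegrable' _ _) (by
          rw [uIcc_of_le (by simp)]
          simp)
    have h2 := h1.mono (c := a) (d := b) (by
      rw [uIcc_of_le (a := min 0 (min a b)) (by simp)]
      exact Icc_subset_Icc (by simp) (by simp))
    exact h2.fun_smul ((LipschitzWith.const w).lipschitzOnWith).absolutelyContinuousOnInterval
  have hre : LocallyIntegrable (fun s => (h s).re) volume := fun x => by
    obtain ⟨s, hs, hi⟩ := hh x; exact ⟨s, hs, hi.re⟩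
  have him : LocallyIntegrable (fun s => (h s).im) volume := fun x => by
    obtain ⟨s, hs, hi⟩ := hh x; exact ⟨s, hs, hi.im⟩
  have h1 := (((LipschitzWith.const C).lipschitzOnWith).absolutelyContinuousOnInterval
    (a := a) (b := b)).fun_add ((key _ hre 1).fun_add (key _ him Complex.I))
  convert h1 using 2 with t
  congr 1
  have e1 : (∫ s in (0 : ℝ)..t, h s).re = ∫ s in (0 : ℝ)..t, (h s).re :=
    (Complex.reCLM.intervalIntegral_comp_comm (hh.intervalIntegrable' _ _)).symm
  have e2 : (∫ s in (0 : ℝ)..t, h s).im = ∫ s in (0 : ℝ)..t, (h s).im :=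
    (Complex.imCLM.intervalIntegral_comp_comm (hh.intervalIntegrable' _ _)).symm
  rw [← e1, ← e2]
  apply Complex.ext <;> simp

theorem eq_of_absolutelyContinuous_of_hasDerivAt_zero {g : ℝ → ℂ}
    (hg : ∀ a b, AbsolutelyContinuousOnInterval g a b) (h0 : ∀ᵐ t, HasDerivAt g 0 t) (t : ℝ) :
    g t = g 0 := by
  obtain ⟨C, hC⟩ := (hg 0 t).const_of_ae_hasDerivAt_zero (h0.mono fun _ h _ => h)
  rw [hC t right_mem_uIcc, hC 0 left_mem_uIcc]

end AbsolutelyContinuous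

theorem mem_derivGraph_iff (c : ℝ) (f h : WeightedL2 c) :
    (f, h) ∈ derivGraph c ↔ ∃ C : ℂ, ∀ᵐ t : ℝ, f t = C + ∫ s in (0 : ℝ)..t, h s := by
  have hh := locallyIntegrable_weightedL2 c h
  have hac := AbsolutelyContinuousOnInterval.integral_complex hh
  have hd := LocallyIntegrable.ae_hasDerivAt_integral hh
  constructor
  · rintro ⟨g, hg, hfg, hg'⟩
    rw [ae_weightedMeasure_iff] at hg'
    refine ⟨g 0, ?_⟩
    have hk := eq_of_absolutelyContinuous_of_hasDerivAt_zero
      (g := fun t => g t - (0 + ∫ s in (0 : ℝ)..t, h s))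
      (fun a b => (hg a b).fun_sub (hac 0 a b)) (by
        filter_upwards [hg', hd] with t h1 h2
        have := h1.sub ((h2 0).const_add 0)
        rwa [sub_self] at this)
    filter_upwards [(ae_weightedMeasure_iff c).1 hfg] with t ht
    have := hk t
    simp only [intervalIntegral.integral_same, zero_add, sub_zero] at this
    rw [ht, ← this, sub_add_cancel]
  · rintro ⟨C, hC⟩
    refine ⟨_, hac C, (ae_weightedMeasure_iff c).2 hC, (ae_weightedMeasure_iff c).2 ?_⟩
    filter_upwards [hd] with t ht using (ht 0).const_add C

theorem exists_inner_eq_setIntegral (c a b : ℝ) :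
    ∃ v : Lp ℂ 2 (volume : Measure ℝ), ∀ h : WeightedL2 c,
      ∫ s in Ioc a b, h s = inner ℂ v (untwist c h) := by
  have hm : MemLp ((Ioc a b).indicator fun t => (Real.exp (c * t) : ℂ)) 2 volume := by
    rw [memLp_indicator_iff_restrict measurableSet_Ioc]
    refine MemLp.of_bound (Continuous.aestronglyMeasurable (by fun_prop))
      (Real.exp (|c| * (|a| + |b|))) ?_
    filter_upwards [ae_restrict_mem measurableSet_Ioc] with t ht
    rw [Complex.norm_real, Real.norm_of_nonneg (Real.exp_pos _).le]
    refine Real.exp_le_exp.2 ((le_abs_self _).trans ?_)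
    rw [abs_mul]
    gcongr
    rcases abs_cases t with h | h <;> rcases abs_cases a with h' | h' <;>
      rcases abs_cases b with h'' | h'' <;> linarith [ht.1, ht.2]
  refine ⟨hm.toLp _, fun h => ?_⟩
  rw [L2.inner_def, ← integral_indicator measurableSet_Ioc]
  refine integral_congr_ae ?_
  filter_upwards [hm.coeFn_toLp, coeFn_eq_exp_mul_untwist c h] with t h1 h2
  rw [h1]
  by_cases ht : t ∈ Ioc a b
  · rw [indicator_of_mem ht, indicator_of_mem ht, h2, RCLike.inner_apply, Complex.conj_ofReal,
      mul_comm]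
  · rw [indicator_of_notMem ht, indicator_of_notMem ht]; simp

theorem continuous_intervalIntegral_weightedL2 (c a b : ℝ) :
    Continuous fun h : WeightedL2 c => ∫ s in a..b, h s := by
  obtain ⟨v, hv⟩ := exists_inner_eq_setIntegral c a b
  obtain ⟨w, hw⟩ := exists_inner_eq_setIntegral c b a
  simp only [intervalIntegral, hv, hw]
  have := (untwist c).continuous
  fun_prop

/-- Integration over a bounded interval is continuous on `ℍ_c`, so along an a.e. convergent
subsequence the constants of integration converge too, and the limit is again a primitive. -/
theorem isClosed_derivGraph (c : ℝ) :
    IsClosed (derivGraph c : Set (WeightedL2 c × WeightedL2 c)) := by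
  refine IsSeqClosed.isClosed fun p q hp hpq => ?_
  obtain ⟨f, h⟩ := q
  have hf : Filter.Tendsto (fun n => (p n).1) Filter.atTop (nhds f) :=
    (continuous_fst.tendsto _).comp hpq
  have hh : Filter.Tendsto (fun n => (p n).2) Filter.atTop (nhds h) :=
    (continuous_snd.tendsto _).comp hpq
  choose C hC using fun n => (mem_derivGraph_iff c (p n).1 (p n).2).1 (hp n)
  obtain ⟨ns, hns, hlim⟩ := (tendstoInMeasure_of_tendsto_Lp hf).exists_seq_tendsto_ae
  have hae : ∀ᵐ t : ℝ, Filter.Tendsto (fun i => C (ns i)) Filter.atTop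
      (nhds (f t - ∫ s in (0 : ℝ)..t, h s)) := by
    filter_upwards [(ae_weightedMeasure_iff c).1 hlim, ae_all_iff.2 hC] with t h1 h2
    have h3 := ((continuous_intervalIntegral_weightedL2 c 0 t).tendsto h).comp
      (hh.comp hns.tendsto_atTop)
    refine (h1.sub h3).congr fun i => ?_
    simp [h2]
  obtain ⟨t₀, ht₀⟩ := hae.exists
  refine (mem_derivGraph_iff c f h).2 ⟨f t₀ - ∫ s in (0 : ℝ)..t₀, h s, ?_⟩
  filter_upwards [hae] with t ht
  rw [tendsto_nhds_unique ht₀ ht, sub_add_cancel]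

/-- Solutions of `d' = (c + 1) d` are multiples of `e^{(c+1)t}`, which untwist to multiples of
`e^t`, not square integrable at `+∞`. The point `c + 1` is a convenient one off the line, at
distance `1`. -/
theorem eq_zero_of_mem_derivGraph (c : ℝ) {d : WeightedL2 c}
    (hd : (d, ((c : ℂ) + 1) • d) ∈ derivGraph c) : d = 0 := by
  obtain ⟨g, hg, hdg, hg'⟩ := hd
  dsimp only at hdg hg'
  rw [Filter.EventuallyEq, ae_weightedMeasure_iff] at hdg
  rw [ae_weightedMeasure_iff] at hg'
  have hsm := (ae_weightedMeasure_iff c).1 (Lp.coeFn_smul ((c : ℂ) + 1) d)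
  have he : ∀ t : ℝ, HasDerivAt (fun t : ℝ => Complex.exp (-(c + 1) * t))
      (-(c + 1) * Complex.exp (-(c + 1) * t)) t := fun t => by
    have := ((Complex.ofRealCLM.hasDerivAt (x := t)).const_mul (-((c : ℂ) + 1))).cexp
    simpa [mul_comm] using this
  have hk := eq_of_absolutelyContinuous_of_hasDerivAt_zero
    (g := fun t : ℝ => Complex.exp (-(c + 1) * t) • g t) (fun a b => by
      refine AbsolutelyContinuousOnInterval.fun_smul ?_ (hg a b)
      refine ContDiffOn.absolutelyContinuousOnInterval (ContDiff.contDiffOn ?_)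
      exact ((contDiff_const.mul Complex.ofRealCLM.contDiff)).cexp) (by
      filter_upwards [hg', hdg, hsm] with t h1 h2 h3
      have := (he t).smul h1
      rw [h3, Pi.smul_apply, h2] at this
      have e : Complex.exp (-(c + 1) * t) • ((c : ℂ) + 1) • g t
          + (-(c + 1) * Complex.exp (-(c + 1) * t)) • g t = 0 := by
        simp only [smul_eq_mul]; ring
      rw [e] at this
      exact this)
  have hJ : ∀ᵐ t : ℝ, untwist c d t = (Real.exp t : ℂ) * g 0 := by
    filter_upwards [coeFn_untwist c d, hdg] with t h1 h2
    have h3 := hk t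
    simp only [Complex.ofReal_zero, mul_zero, Complex.exp_zero, smul_eq_mul, one_mul] at h3
    have h4 : (Real.exp (-c * t) : ℂ) = Real.exp t * Complex.exp (-(c + 1) * t) := by
      rw [Complex.ofReal_exp, Complex.ofReal_exp, ← Complex.exp_add]
      congr 1; push_cast; ring
    rw [h1, h2, h4, mul_assoc, h3]
  have hL : MemLp (fun _ : ℝ => g 0) 2 (volume.restrict (Ioi (0 : ℝ))) := by
    refine ((Lp.memLp (untwist c d)).restrict (Ioi 0)).mono aestronglyMeasurable_const ?_
    filter_upwards [ae_restrict_of_ae hJ, ae_restrict_mem measurableSet_Ioi] with t h1 h2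
    rw [h1, norm_mul, Complex.norm_real, Real.norm_of_nonneg (Real.exp_pos _).le]
    have : 1 ≤ Real.exp t := Real.one_le_exp (le_of_lt h2)
    nlinarith [norm_nonneg (g 0)]
  have hg0 : g 0 = 0 := by
    rcases (memLp_const_iff (by norm_num) (by norm_num)).1 hL with h | h
    · exact h
    · simp at h
  rw [← (untwist c).map_eq_zero_iff]
  refine Lp.ext ?_
  filter_upwards [hJ, Lp.coeFn_zero ℂ 2 (volume : Measure ℝ)] with t h1 h2
  rw [h1, h2, hg0, mul_zero, Pi.zero_apply]

/-! ### Fourier diagonalization of `∂`. -/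

open FourierTransform SchwartzMap

/-- The parametrization `ξ ↦ c + 2πiξ` of the line `Re s = c`. -/
noncomputable def lineParam (c : ℝ) (ξ : ℝ) : ℂ := c + 2 * Real.pi * Complex.I * ξ

theorem continuous_lineParam (c : ℝ) : Continuous (lineParam c) := by
  unfold lineParam; fun_prop

theorem lineParam_re (c ξ : ℝ) : (lineParam c ξ).re = c := by simp [lineParam]

theorem lineParam_im (c ξ : ℝ) : (lineParam c ξ).im = 2 * Real.pi * ξ := by simp [lineParam]

theorem lineParam_sub_ne_zero (c ξ : ℝ) : lineParam c ξ - (c + 1) ≠ 0 := by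
  intro h
  have := congrArg Complex.re h
  simp [lineParam] at this

theorem norm_inv_lineParam_sub_le (c ξ : ℝ) : ‖(lineParam c ξ - (c + 1))⁻¹‖ ≤ 1 := by
  rw [norm_inv]
  refine inv_le_one_of_one_le₀ ?_
  have := Complex.abs_re_le_norm (lineParam c ξ - (c + 1))
  simpa [lineParam] using this

theorem hasTemperateGrowth_lineParam (c : ℝ) : (lineParam c).HasTemperateGrowth := by
  unfold lineParam
  fun_prop

theorem hasTemperateGrowth_inv_lineParam_sub (c : ℝ) :
    (fun ξ => (lineParam c ξ - (c + 1))⁻¹).HasTemperateGrowth := by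
  have h1 : (fun ξ : ℝ => (1 + ‖2 * Real.pi * ξ‖ ^ 2) ^ (-1 : ℝ)).HasTemperateGrowth := by
    have := (Function.hasTemperateGrowth_one_add_norm_sq_rpow ℝ (-1)).comp
      (f := fun ξ : ℝ => 2 * Real.pi * ξ) (by fun_prop)
    exact this
  have h2 : (fun ξ : ℝ => (((1 + ‖2 * Real.pi * ξ‖ ^ 2) ^ (-1 : ℝ) : ℝ) : ℂ)).HasTemperateGrowth :=
    Function.Complex.hasTemperateGrowth_ofReal.comp h1
  -- Rationalizing: `(2πiξ - 1)⁻¹ = -(1 + 2πiξ) / (1 + 4π²ξ²)`.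
  have h3 : (fun ξ : ℝ => -(1 + (lineParam c ξ - c)) *
      (((1 + ‖2 * Real.pi * ξ‖ ^ 2) ^ (-1 : ℝ) : ℝ) : ℂ)).HasTemperateGrowth := by
    have := hasTemperateGrowth_lineParam c
    fun_prop
  convert h3 using 2 with ξ
  refine inv_eq_of_mul_eq_one_right ?_
  rw [Real.rpow_neg_one, Complex.ofReal_inv, ← mul_assoc, ← div_eq_mul_inv, div_eq_one_iff_eq]
  · simp only [lineParam, Real.norm_eq_abs, sq_abs]
    push_cast
    linear_combination (-4 * (Real.pi : ℂ) ^ 2 * ξ ^ 2) * Complex.I_sq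
  · rw [Complex.ofReal_ne_zero]; positivity

/-- The unitary map `f ↦ 𝓕(e^{-ct} f(t))` that diagonalizes `d/dt` on `L²(ℝ, e^{-2ct} dt)`. -/
noncomputable def twistedFourier (c : ℝ) : WeightedL2 c ≃ₗᵢ[ℂ] Lp ℂ 2 (volume : Measure ℝ) :=
  (untwist c).trans (Lp.fourierTransformₗᵢ ℝ ℂ)

theorem twistedFourier_symm_toLp (c : ℝ) (v : 𝓢(ℝ, ℂ)) :
    (twistedFourier c).symm (v.toLp 2) =ᵐ[volume]
      fun t => (Real.exp (c * t) : ℂ) * (𝓕⁻ v : 𝓢(ℝ, ℂ)) t := by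
  have e : (twistedFourier c).symm (v.toLp 2) = (untwist c).symm ((𝓕⁻ v : 𝓢(ℝ, ℂ)).toLp 2) := by
    rw [← SchwartzMap.toLp_fourierInv_eq]; rfl
  rw [e]
  filter_upwards [coeFn_untwist_symm c ((𝓕⁻ v : 𝓢(ℝ, ℂ)).toLp 2), (𝓕⁻ v : 𝓢(ℝ, ℂ)).coeFn_toLp 2]
    with t h1 h2
  rw [h1, h2]

theorem schwartz_mem_derivGraph (c : ℝ) (v : 𝓢(ℝ, ℂ)) :
    ((twistedFourier c).symm (v.toLp 2),
      (twistedFourier c).symm ((smulLeftCLM ℂ (lineParam c) v).toLp 2)) ∈ derivGraph c := by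
  have hd : ∀ t, HasDerivAt (fun t : ℝ => (Real.exp (c * t) : ℂ) * (𝓕⁻ v : 𝓢(ℝ, ℂ)) t)
      ((Real.exp (c * t) : ℂ) * (𝓕⁻ (smulLeftCLM ℂ (lineParam c) v) : 𝓢(ℝ, ℂ)) t) t := by
    intro t
    have h1 : HasDerivAt (fun t : ℝ => (Real.exp (c * t) : ℂ))
        ((Real.exp (c * t) * c : ℝ) : ℂ) t := by
      refine HasDerivAt.ofReal_comp ?_
      simpa using ((hasDerivAt_id t).const_mul c).exp
    have h2 := (𝓕⁻ v : 𝓢(ℝ, ℂ)).hasDerivAt t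
    have h3 : deriv (𝓕⁻ v : 𝓢(ℝ, ℂ)) t
        = (𝓕⁻ ((2 * Real.pi * Complex.I) • smulLeftCLM ℂ (fun x : ℝ => inner ℝ x (1 : ℝ)) v) :
          𝓢(ℝ, ℂ)) t := by
      rw [← SchwartzMap.lineDerivOp_fourierInv_eq, SchwartzMap.lineDerivOp_apply_eq_fderiv,
        fderiv_apply_one_eq_deriv]
    have h4 : smulLeftCLM ℂ (lineParam c) v = (c : ℂ) • v
        + (2 * Real.pi * Complex.I) • smulLeftCLM ℂ (fun x : ℝ => inner ℝ x (1 : ℝ)) v := by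
      ext ξ
      rw [SchwartzMap.smulLeftCLM_apply_apply (hasTemperateGrowth_lineParam c)]
      simp only [_root_.add_apply, _root_.smul_apply]
      rw [SchwartzMap.smulLeftCLM_apply_apply (by fun_prop)]
      simp [lineParam]
      ring
    have := h1.mul h2
    rw [h3] at this
    have e : (𝓕⁻ (smulLeftCLM ℂ (lineParam c) v) : 𝓢(ℝ, ℂ)) t = c * (𝓕⁻ v : 𝓢(ℝ, ℂ)) t
        + (𝓕⁻ ((2 * Real.pi * Complex.I) • smulLeftCLM ℂ (fun x : ℝ => inner ℝ x (1 : ℝ)) v) :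
          𝓢(ℝ, ℂ)) t := by
      rw [h4, FourierInvAdd.fourierInv_add, FourierInvSMul.fourierInv_smul,
        _root_.add_apply, _root_.smul_apply, smul_eq_mul]
    rw [e, mul_add, ← mul_assoc, ← Complex.ofReal_mul]
    exact this
  refine ⟨fun t => (Real.exp (c * t) : ℂ) * (𝓕⁻ v : 𝓢(ℝ, ℂ)) t, fun a b => ?_,
    (ae_weightedMeasure_iff c).2 (twistedFourier_symm_toLp c v), (ae_weightedMeasure_iff c).2 ?_⟩
  · refine ContDiffOn.absolutelyContinuousOnInterval (ContDiff.contDiffOn ?_)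
    refine ContDiff.mul ?_ (((𝓕⁻ v : 𝓢(ℝ, ℂ)).smooth 1))
    exact Complex.ofRealCLM.contDiff.comp (contDiff_const.mul contDiff_id).exp
  · filter_upwards [twistedFourier_symm_toLp c (smulLeftCLM ℂ (lineParam c) v)] with t ht
    rw [ht]
    exact hd t

theorem memLp_top_inv_lineParam_sub (c : ℝ) :
    MemLp (fun ξ => (lineParam c ξ - (c + 1))⁻¹) ∞ (volume : Measure ℝ) :=
  memLp_top_of_bound
    (hasTemperateGrowth_inv_lineParam_sub c).1.continuous.aestronglyMeasurable 1
    (.of_forall fun ξ => norm_inv_lineParam_sub_le c ξ)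

/-- In the Fourier picture `∂ - (c + 1)` has a bounded right inverse. For Schwartz `w` this is
explicit differentiation; density and the closed graph give the rest. -/
theorem resolvent_mem_derivGraph (c : ℝ) (w : Lp ℂ 2 (volume : Measure ℝ)) :
    ((twistedFourier c).symm (mulL2 volume (fun ξ => (lineParam c ξ - (c + 1))⁻¹) w),
      (twistedFourier c).symm
        (w + ((c : ℂ) + 1) • mulL2 volume (fun ξ => (lineParam c ξ - (c + 1))⁻¹) w))
      ∈ derivGraph c := by
  have hcl : IsClosed {w : Lp ℂ 2 (volume : Measure ℝ) |
      ((twistedFourier c).symm (mulL2 volume (fun ξ => (lineParam c ξ - (c + 1))⁻¹) w),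
      (twistedFourier c).symm
        (w + ((c : ℂ) + 1) • mulL2 volume (fun ξ => (lineParam c ξ - (c + 1))⁻¹) w))
      ∈ derivGraph c} := by
    refine (isClosed_derivGraph c).preimage ?_
    have := (twistedFourier c).symm.continuous
    fun_prop
  refine (SchwartzMap.denseRange_toLpCLM (E := ℝ) (F := ℂ) (p := 2)
    (μ := volume) ENNReal.ofNat_ne_top).induction_on w hcl fun (w : 𝓢(ℝ, ℂ)) => ?_
  rw [SchwartzMap.toLpCLM_apply]
  set v := smulLeftCLM ℂ (fun ξ => (lineParam c ξ - (c + 1))⁻¹) w with hv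
  have hva : ∀ ξ, v ξ = (lineParam c ξ - (c + 1))⁻¹ * w ξ := fun ξ => by
    rw [hv, SchwartzMap.smulLeftCLM_apply_apply (hasTemperateGrowth_inv_lineParam_sub c),
      smul_eq_mul]
  have h1 : mulL2 volume (fun ξ => (lineParam c ξ - (c + 1))⁻¹) (w.toLp 2) = v.toLp 2 := by
    refine Lp.ext ?_
    filter_upwards [coeFn_mulL2 (memLp_top_inv_lineParam_sub c) (w.toLp 2), w.coeFn_toLp 2,
      v.coeFn_toLp 2] with ξ h1 h2 h3
    rw [h1, h2, h3, hva]
  have h2 : w.toLp 2 volume + ((c : ℂ) + 1) • v.toLp 2 volume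
      = (smulLeftCLM ℂ (lineParam c) v).toLp 2 volume := by
    refine Lp.ext ?_
    filter_upwards [Lp.coeFn_add (w.toLp 2 volume) (((c : ℂ) + 1) • v.toLp 2 volume),
      Lp.coeFn_smul ((c : ℂ) + 1) (v.toLp 2 volume), w.coeFn_toLp 2,
      v.coeFn_toLp 2, (smulLeftCLM ℂ (lineParam c) v).coeFn_toLp 2] with ξ h1 h2 h3 h4 h5
    rw [h1, Pi.add_apply, h2, Pi.smul_apply, h3, h4, h5,
      SchwartzMap.smulLeftCLM_apply_apply (hasTemperateGrowth_lineParam c), hva, smul_eq_mul,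
      smul_eq_mul]
    have := lineParam_sub_ne_zero c ξ
    field_simp
    ring
  rw [h1, h2]
  exact schwartz_mem_derivGraph c v

/-- With `w = W y - (c + 1) W x`, both sides say that `W x` is the resolvent multiplier applied to
`w`. From left to right, the difference of two graph elements is an eigenvector for `c + 1`, hence
zero. This identifies the domain of `∂` exactly. -/
theorem mem_derivGraph_iff_twistedFourier (c : ℝ) (x y : WeightedL2 c) :
    (x, y) ∈ derivGraph c ↔
      twistedFourier c y =ᵐ[volume] fun ξ => lineParam c ξ * twistedFourier c x ξ := by
  set W := twistedFourier c with hW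
  set m : ℝ → ℂ := fun ξ => (lineParam c ξ - (c + 1))⁻¹ with hm
  set w := W y - ((c : ℂ) + 1) • W x with hw
  have hwae : w =ᵐ[volume] fun ξ => W y ξ - (c + 1) * W x ξ := by
    filter_upwards [Lp.coeFn_sub (W y) (((c : ℂ) + 1) • W x),
      Lp.coeFn_smul ((c : ℂ) + 1) (W x)] with ξ h1 h2
    rw [hw, h1, Pi.sub_apply, h2, Pi.smul_apply, smul_eq_mul]
  have hmw := coeFn_mulL2 (memLp_top_inv_lineParam_sub c) w
  have hres := resolvent_mem_derivGraph c w
  have key : W x = mulL2 volume m w ↔ W y =ᵐ[volume] fun ξ => lineParam c ξ * W x ξ := by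
    constructor
    · intro h
      filter_upwards [hwae, hmw] with ξ h1 h2
      rw [h1] at h2
      have h3 : W x ξ = (lineParam c ξ - (c + 1))⁻¹ * (W y ξ - (c + 1) * W x ξ) := by
        rw [← h2]; exact congrArg (fun u : Lp ℂ 2 (volume : Measure ℝ) => u ξ) h
      rw [eq_inv_mul_iff_mul_eq₀ (lineParam_sub_ne_zero c ξ)] at h3
      linear_combination -h3
    · intro h
      refine Lp.ext ?_
      filter_upwards [hwae, hmw, h] with ξ h1 h2 h3
      rw [h2, h1, h3, eq_inv_mul_iff_mul_eq₀ (lineParam_sub_ne_zero c ξ)]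
      ring
  have hy : W.symm (w + ((c : ℂ) + 1) • W x) = y := by
    rw [hw, sub_add_cancel, W.symm_apply_apply]
  rw [← key]
  constructor
  · intro h
    have hd := (derivGraph c).sub_mem h hres
    have hz : x - W.symm (mulL2 volume m w) = 0 := by
      refine eq_zero_of_mem_derivGraph c ?_
      have e : ((c : ℂ) + 1) • (x - W.symm (mulL2 volume m w))
          = y - W.symm (w + ((c : ℂ) + 1) • mulL2 volume m w) := by
        conv_rhs => rw [← hy]
        rw [map_add, map_add, map_smul, map_smul, W.symm_apply_apply, smul_sub]
        abel
      rw [e]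
      exact hd
    rw [sub_eq_zero] at hz
    rw [hz, W.apply_symm_apply]
  · intro h
    rw [← hW, ← hm, ← h, hy, W.symm_apply_apply] at hres
    exact hres

/-! ### The spectrum of functions of `∂`. -/

theorem measurableEmbedding_lineParam (c : ℝ) : MeasurableEmbedding (lineParam c) := by
  refine (continuous_lineParam c).measurableEmbedding fun a b h => ?_
  have := congrArg Complex.im h
  rw [lineParam_im, lineParam_im] at this
  exact mul_left_cancel₀ (by positivity) this

theorem isClosed_verticalLine (c : ℝ) : IsClosed {s : ℂ | s.re = c} :=
  isClosed_eq Complex.continuous_re continuous_const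

theorem mem_graph_infinitesimalShift_iff (c : ℝ) (x y : WeightedL2 c) :
    (x, y) ∈ (infinitesimalShift c).graph ↔
      twistedFourier c y =ᵐ[volume] fun ξ => lineParam c ξ * twistedFourier c x ξ := by
  rw [infinitesimalShift_graph, mem_derivGraph_iff_twistedFourier]

theorem isSpectralMeasureOf_infinitesimalShift (c : ℝ) :
    (multiplicationPVM (twistedFourier c) (measurableEmbedding_lineParam c).measurable
      ).IsSpectralMeasureOf (infinitesimalShift c) :=
  isIntegral_multiplicationPVM (f := fun z => z) (twistedFourier c)
    (measurableEmbedding_lineParam c) (continuous_lineParam c).aestronglyMeasurable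
    (mem_graph_infinitesimalShift_iff c)

theorem isFunctionOf_boundedFunctionOf (c : ℝ) {f : ℂ → ℂ}
    (hf : ContinuousOn f {s : ℂ | s.re = c}) (hb : Bornology.IsBounded (f '' {s : ℂ | s.re = c})) :
    IsFunctionOf f (infinitesimalShift c)
      ((boundedFunctionOf f (infinitesimalShift c) :
        WeightedL2 c →ₗ[ℂ] WeightedL2 c).toPMap ⊤) := by
  have hcont : Continuous (f ∘ lineParam c) :=
    hf.comp_continuous (continuous_lineParam c) (lineParam_re c)
  obtain ⟨C, hC⟩ := hb.exists_norm_le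
  have hmem : MemLp (f ∘ lineParam c) ∞ (volume : Measure ℝ) :=
    memLp_top_of_bound hcont.aestronglyMeasurable C
      (.of_forall fun ξ => hC _ (mem_image_of_mem f (lineParam_re c ξ)))
  refine Classical.epsilon_spec (p := fun A : WeightedL2 c →L[ℂ] WeightedL2 c =>
    IsFunctionOf f (infinitesimalShift c) ((A : WeightedL2 c →ₗ[ℂ] WeightedL2 c).toPMap ⊤))
    ⟨(twistedFourier c).symm.conjStarAlgEquiv (mulL2 volume (f ∘ lineParam c)), _,
      isSpectralMeasureOf_infinitesimalShift c, isIntegral_multiplicationPVM _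
        (measurableEmbedding_lineParam c) hcont.aestronglyMeasurable fun x y => ?_⟩
  have hx := coeFn_mulL2 hmem (twistedFourier c x)
  rw [LinearPMap.mem_graph_iff]
  constructor
  · rintro ⟨u, hu, huy⟩
    dsimp only at hu huy
    have e : y = (twistedFourier c).symm (mulL2 volume (f ∘ lineParam c) (twistedFourier c x)) := by
      rw [← huy, ← hu]; rfl
    rw [e, LinearIsometryEquiv.apply_symm_apply]
    exact hx
  · intro h
    refine ⟨⟨x, trivial⟩, rfl, ?_⟩
    have e : twistedFourier c y = mulL2 volume (f ∘ lineParam c) (twistedFourier c x) :=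
      Lp.ext (h.trans hx.symm)
    rw [← (twistedFourier c).symm_apply_apply y, e]
    rfl

theorem re_inner_infinitesimalShift (c : ℝ) (x : (infinitesimalShift c).domain) :
    (inner ℂ (x : WeightedL2 c) (infinitesimalShift c x)).re = c * ‖(x : WeightedL2 c)‖ ^ 2 := by
  have h := (mem_graph_infinitesimalShift_iff c _ _).1 ((infinitesimalShift c).mem_graph x)
  have hn : ‖(x : WeightedL2 c)‖ ^ 2
      = (inner ℂ (twistedFourier c x) (twistedFourier c x)).re := by
    rw [← (twistedFourier c).norm_map];
    exact (inner_self_eq_norm_sq (𝕜 := ℂ) (twistedFourier c x)).symm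
  rw [hn, ← (twistedFourier c).inner_map_map, L2.inner_def, L2.inner_def]
  refine ((integral_re (L2.integrable_inner (𝕜 := ℂ) (twistedFourier c x)
    (twistedFourier c (infinitesimalShift c x)))).symm.trans ?_).trans
    (congrArg (c * ·) (integral_re (L2.integrable_inner (𝕜 := ℂ) (twistedFourier c x)
      (twistedFourier c x))))
  rw [← integral_const_mul]
  refine integral_congr_ae ?_
  filter_upwards [h] with ξ hξ
  rw [hξ]
  simp only [RCLike.inner_apply, mul_assoc, Complex.mul_conj, RCLike.re_to_complex,
    Complex.re_mul_ofReal, lineParam_re, Complex.ofReal_re]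

/-- Approximate eigenvectors: the Fourier transform of `x` is the indicator of a frequency interval
of length `r / (2π)` starting where `lineParam c` hits `z`. -/
theorem exists_norm_infinitesimalShift_sub_le {c : ℝ} {z : ℂ} (hz : z.re = c) {r : ℝ}
    (hr : 0 < r) : ∃ x : (infinitesimalShift c).domain, (x : WeightedL2 c) ≠ 0 ∧
      ‖infinitesimalShift c x - z • (x : WeightedL2 c)‖ ≤ r * ‖(x : WeightedL2 c)‖ := by
  have hpi := Real.pi_pos
  set ξ₀ := z.im / (2 * Real.pi) with hξ₀
  set I := Icc ξ₀ (ξ₀ + r / (2 * Real.pi)) with hI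
  have hIm : MeasurableSet I := measurableSet_Icc
  have hI0 : 0 < r / (2 * Real.pi) := by positivity
  set u : Lp ℂ 2 (volume : Measure ℝ) :=
    indicatorConstLp 2 hIm (measure_Icc_lt_top.ne) (1 : ℂ) with hu
  have hune : u ≠ 0 := by
    rw [← norm_ne_zero_iff, hu, norm_indicatorConstLp (by norm_num) (by norm_num)]
    simp only [norm_one, one_mul, measureReal_def, Real.volume_Icc, hI]
    rw [add_sub_cancel_left, ENNReal.toReal_ofReal hI0.le]
    positivity
  have huae : u =ᵐ[volume] I.indicator fun _ => 1 := indicatorConstLp_coeFn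
  have hbound : ∀ ξ ∈ I, ‖lineParam c ξ - z‖ ≤ r := by
    intro ξ hξ
    have h1 : lineParam c ξ - z = ((2 * Real.pi * (ξ - ξ₀) : ℝ) : ℂ) * Complex.I := by
      have h2 : 2 * Real.pi * ξ₀ = z.im := by rw [hξ₀]; field_simp
      apply Complex.ext
      · simp [lineParam_re, hz]
      · rw [Complex.sub_im, lineParam_im, mul_sub, h2]; simp
    rw [h1, norm_mul, Complex.norm_I, mul_one, Complex.norm_real, Real.norm_of_nonneg]
    · have h3 : ξ - ξ₀ ≤ r / (2 * Real.pi) := by linarith [hξ.2]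
      rw [le_div_iff₀ (by positivity)] at h3
      linarith
    · have := hξ.1
      have : 0 ≤ ξ - ξ₀ := by linarith
      positivity
  have hmem : MemLp (fun ξ => lineParam c ξ * u ξ) 2 volume := by
    refine MemLp.of_le_mul (g := u) (c := r + ‖z‖) (Lp.memLp u)
      ((continuous_lineParam c).aestronglyMeasurable.mul (Lp.aestronglyMeasurable u)) ?_
    filter_upwards [huae] with ξ hξ
    rw [hξ]
    by_cases h : ξ ∈ I
    · rw [norm_mul]
      gcongr
      calc ‖lineParam c ξ‖ = ‖(lineParam c ξ - z) + z‖ := by rw [sub_add_cancel]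
        _ ≤ _ := (norm_add_le _ _).trans (by gcongr; exact hbound ξ h)
    · simp [h]
  set W := twistedFourier c with hW
  have hgraph : (W.symm u, W.symm (hmem.toLp _)) ∈ (infinitesimalShift c).graph := by
    rw [mem_graph_infinitesimalShift_iff, ← hW, W.apply_symm_apply, W.apply_symm_apply]
    exact hmem.coeFn_toLp
  obtain ⟨x, hx, hxy⟩ := (LinearPMap.mem_graph_iff _).1 hgraph
  dsimp only at hx hxy
  refine ⟨x, ?_, ?_⟩
  · rw [hx]; simpa using hune
  · rw [hxy, hx, ← map_smul, ← map_sub, W.symm.norm_map, W.symm.norm_map]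
    refine Lp.norm_le_mul_norm_of_ae_le_mul ?_
    filter_upwards [Lp.coeFn_sub (hmem.toLp _) (z • u), Lp.coeFn_smul z u, hmem.coeFn_toLp, huae]
      with ξ h1 h2 h3 h4
    rw [h1, Pi.sub_apply, h2, h3, Pi.smul_apply, smul_eq_mul, ← sub_mul, norm_mul]
    by_cases h : ξ ∈ I
    · gcongr; exact hbound ξ h
    · rw [h4]; simp [h]

theorem isStarNormal_and_spectrum_boundedFunctionOf (c : ℝ) {f : ℂ → ℂ}
    (hf : ContinuousOn f {s : ℂ | s.re = c}) (hb : Bornology.IsBounded (f '' {s : ℂ | s.re = c})) :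
    IsStarNormal (boundedFunctionOf f (infinitesimalShift c)) ∧
      spectrum ℂ (boundedFunctionOf f (infinitesimalShift c))
        = closure (f '' {s : ℂ | s.re = c}) := by
  -- `E` is an unspecified spectral measure; only its support is used below.
  obtain ⟨E, hE, hA⟩ := isFunctionOf_boundedFunctionOf c hf hb
  have hline := hE.proj_compl_verticalLine (re_inner_infinitesimalShift c)
  have hne : {s : ℂ | s.re = c}.Nonempty := ⟨c, Complex.ofReal_re c⟩
  have hsupp : ∀ z ∈ {s : ℂ | s.re = c}, ∀ r > 0, E.proj (Metric.ball z r) ≠ 0 := by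
    intro z hz r hr h0
    -- An approximate eigenvector with error `r / 2` contradicts the lower bound `r` that a null
    -- ball would give.
    obtain ⟨x, hx0, hx⟩ := exists_norm_infinitesimalShift_sub_le hz (half_pos hr)
    have h1 := hE.mul_norm_le (z₀ := z) (by rw [show z.re = c from hz]; exact hline) h0 x
    have : 0 < ‖(x : WeightedL2 c)‖ := norm_pos_iff.2 hx0
    nlinarith
  have hA' : ∀ x, inner ℂ x (boundedFunctionOf f (infinitesimalShift c) x)
      = ∫ z, f z ∂(E.scalarMeasure x) := fun x => hA.2 ⟨x, trivial⟩
  exact ⟨E.isStarNormal_of_isIntegral (isClosed_verticalLine c) hne hline hf hb hA',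
    E.spectrum_eq_closure (isClosed_verticalLine c) hne hline hsupp hf hb hA'⟩

/-! ### Invertibility of the truncated spectral operators. -/

theorem mem_segment_vertical_iff {c T : ℝ} (hT : 0 < T) (z : ℂ) :
    z ∈ segment ℝ (c - T * Complex.I : ℂ) (c + T * Complex.I : ℂ) ↔ z.re = c ∧ |z.im| ≤ T := by
  rw [segment_eq_image']
  constructor
  · rintro ⟨t, ⟨h0, h1⟩, rfl⟩
    refine ⟨by simp, ?_⟩
    rw [abs_le]
    constructor <;> simp <;> nlinarith
  · rintro ⟨h1, h2⟩
    obtain ⟨h3, h4⟩ := abs_le.1 h2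
    obtain ⟨t, ht⟩ : ∃ t : ℝ, t * (2 * T) = z.im + T :=
      ⟨(z.im + T) / (2 * T), div_mul_cancel₀ _ (by positivity)⟩
    refine ⟨t, ⟨by nlinarith, by nlinarith⟩, ?_⟩
    apply Complex.ext
    · simp [h1]
    · simp; linarith

/-- Spectral mapping on the segment; `c ≠ 1` keeps the pole of `ζ` off it. -/
theorem isUnit_truncatedSpectralOperator_iff {c T : ℝ} (hc : c ≠ 1) (hT : 0 < T) {φ : ℂ → ℂ}
    (hφ : IsCutoff c T φ) : IsUnit (truncatedSpectralOperator c φ) ↔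
      ∀ s : ℂ, s.re = c → |s.im| ≤ T → riemannZeta s ≠ 0 := by
  have hb : Bornology.IsBounded (φ '' {s | s.re = c}) := by
    refine Bornology.IsBounded.subset ?_ subset_closure
    rw [hφ.2, segment_eq_image']
    exact (isCompact_Icc.image (by fun_prop)).isBounded
  obtain ⟨hn, hs⟩ := isStarNormal_and_spectrum_boundedFunctionOf c hφ.1 hb
  have hs' : spectrum ℂ (truncatedShift c φ) = {s : ℂ | s.re = c ∧ |s.im| ≤ T} := by
    rw [truncatedShift, hs, hφ.2]
    ext z
    exact mem_segment_vertical_iff hT z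
  have hcont : ContinuousOn riemannZeta (spectrum ℂ (truncatedShift c φ)) := by
    rw [hs']
    intro s hs
    refine (differentiableAt_riemannZeta ?_).continuousAt.continuousWithinAt
    rintro rfl
    exact hc (hs.1.symm.trans Complex.one_re)
  rw [truncatedSpectralOperator, isUnit_cfc_iff _ _ hcont hn, hs']
  exact ⟨fun h s h1 h2 => h s ⟨h1, h2⟩, fun h s hs => h s hs.1 hs.2⟩

theorem spectralOperatorQuasiInvertible_iff {c : ℝ} (hc : c ≠ 1) {φ : ℝ → ℂ → ℂ}
    (hφ : ∀ T : ℝ, 0 < T → IsCutoff c T (φ T)) : SpectralOperatorQuasiInvertible c φ ↔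
      ∀ s : ℂ, s.re = c → riemannZeta s ≠ 0 := by
  constructor
  · intro h s hs
    have hT : 0 < |s.im| + 1 := by positivity
    exact (isUnit_truncatedSpectralOperator_iff hc hT (hφ _ hT)).1 (h _ hT) s hs (by linarith)
  · intro h T hT
    exact (isUnit_truncatedSpectralOperator_iff hc hT (hφ T hT)).2 fun s hs _ => h s hs

/-! ### Zeros of `ζ` and the Riemann hypothesis. -/

theorem riemannZeta_one_sub_eq_zero {s : ℂ} (h0 : 0 < s.re) (h1 : s ≠ 1) (h : riemannZeta s = 0) :
    riemannZeta (1 - s) = 0 := by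
  rw [riemannZeta_one_sub (fun n hn => ?_) h1, h, mul_zero]
  rw [hn] at h0
  simp at h0
  linarith [(Nat.cast_nonneg n : (0 : ℝ) ≤ n)]

/-- In the functional equation at `1 - s`, whose real part is at least `1`, only the cosine factor
can vanish. -/
theorem exists_eq_neg_two_mul_of_riemannZeta_eq_zero {s : ℂ} (hre : s.re ≤ 0)
    (h : riemannZeta s = 0) : ∃ n : ℕ, s = -2 * (n + 1) := by
  have hs0 : s ≠ 0 := by
    rintro rfl
    rw [riemannZeta_zero] at h
    norm_num at h
  have hre1 : 1 ≤ (1 - s).re := by simp; linarith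
  have hpole : ∀ n : ℕ, 1 - s ≠ -n := fun n hn => by
    rw [hn] at hre1
    simp at hre1
    linarith [(Nat.cast_nonneg n : (0 : ℝ) ≤ n)]
  have hfe := riemannZeta_one_sub hpole (by simpa using hs0)
  rw [sub_sub_cancel, h] at hfe
  have hz := riemannZeta_ne_zero_of_one_le_re hre1
  have hg := Complex.Gamma_ne_zero hpole
  have hp : (2 * (Real.pi : ℂ)) ^ (-(1 - s)) ≠ 0 := by
    rw [Complex.cpow_ne_zero_iff]
    left
    exact mul_ne_zero two_ne_zero (Complex.ofReal_ne_zero.2 Real.pi_ne_zero)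
  have hcos : Complex.cos (Real.pi * (1 - s) / 2) = 0 := by
    simpa [hz, hg, hp] using hfe.symm
  obtain ⟨k, hk⟩ := Complex.cos_eq_zero_iff.1 hcos
  have hpi : (Real.pi : ℂ) ≠ 0 := Complex.ofReal_ne_zero.2 Real.pi_ne_zero
  have hsk : s = -2 * k := by
    have : (Real.pi : ℂ) * (1 - s) = Real.pi * (2 * k + 1) := by linear_combination 2 * hk
    have := mul_left_cancel₀ hpi this
    linear_combination -this
  have hk0 : 0 ≤ k := by
    rw [hsk] at hre
    simp at hre
    exact hre
  have hk1 : k ≠ 0 := by rintro rfl; simp at hsk; exact hs0 hsk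
  -- Trivial zeros are indexed from `-2`, so `n = k - 1`; `k = 0` was excluded by `ζ(0) ≠ 0`.
  refine ⟨(k - 1).toNat, ?_⟩
  have : (((k - 1).toNat : ℤ) : ℂ) = k - 1 := by
    rw [Int.toNat_of_nonneg (by omega)]; push_cast; ring
  rw [hsk, ← Int.cast_natCast, this]
  ring

theorem RiemannHypothesis.riemannZeta_ne_zero (h : RiemannHypothesis) {s : ℂ} (h0 : 0 < s.re)
    (h1 : s.re < 1) (h2 : s.re ≠ 1 / 2) : riemannZeta s ≠ 0 := by
  refine fun hs => h2 (h s hs ?_ ?_)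
  · rintro ⟨n, rfl⟩
    simp at h0
    linarith [(Nat.cast_nonneg n : (0 : ℝ) ≤ n)]
  · rintro rfl
    simp at h1

/-- The reflection `s ↦ 1 - s` carries zeros in the right half of the critical strip to the left
half. Hence the range `(0, 1/2)` of part (b) already suffices. -/
theorem riemannHypothesis_of_riemannZeta_ne_zero
    (h : ∀ s : ℂ, 0 < s.re → s.re < 1 / 2 → riemannZeta s ≠ 0) : RiemannHypothesis := by
  intro s hs htriv hs1
  have hlt : s.re < 1 := not_le.1 fun hle => riemannZeta_ne_zero_of_one_le_re hle hs
  have hpos : 0 < s.re := not_le.1 fun hle =>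
    htriv (exists_eq_neg_two_mul_of_riemannZeta_eq_zero hle hs)
  rcases lt_trichotomy s.re (1 / 2) with h1 | h1 | h1
  · exact absurd hs (h s hpos h1)
  · exact h1
  · refine absurd (riemannZeta_one_sub_eq_zero hpos hs1 hs) (h _ ?_ ?_) <;> simp <;> linarith

theorem theorem7p4 (φ : ℝ → ℝ → ℂ → ℂ)
    (hφ : ∀ c : ℝ, c ∈ Set.Ioo (0 : ℝ) 1 → ∀ T : ℝ, 0 < T → IsCutoff c T (φ c T)) :
    ((∀ c : ℝ, c ∈ Set.Ioo (0 : ℝ) 1 → c ≠ 1 / 2 → SpectralOperatorQuasiInvertible c (φ c)) ↔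
      RiemannHypothesis) ∧
    ((∀ c : ℝ, c ∈ Set.Ioo (0 : ℝ) (1 / 2) → SpectralOperatorQuasiInvertible c (φ c)) ↔
      RiemannHypothesis) := by
  have key : ∀ c : ℝ, c ∈ Set.Ioo (0 : ℝ) 1 → (SpectralOperatorQuasiInvertible c (φ c) ↔
      ∀ s : ℂ, s.re = c → riemannZeta s ≠ 0) := fun c hc =>
    spectralOperatorQuasiInvertible_iff hc.2.ne (hφ c hc)
  have hsub : ∀ c : ℝ, c ∈ Set.Ioo (0 : ℝ) (1 / 2) → c ∈ Set.Ioo (0 : ℝ) 1 := fun c hc =>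
    ⟨hc.1, hc.2.trans (by norm_num)⟩
  refine ⟨⟨fun h => ?_, fun h c hc hc2 => ?_⟩, ⟨fun h => ?_, fun h c hc => ?_⟩⟩
  · refine riemannHypothesis_of_riemannZeta_ne_zero fun s h0 h1 => ?_
    have hc := hsub s.re ⟨h0, h1⟩
    exact (key _ hc).1 (h _ hc h1.ne) s rfl
  · refine (key c hc).2 fun s hs => h.riemannZeta_ne_zero ?_ ?_ ?_ <;> rw [hs]
    exacts [hc.1, hc.2, hc2]
  · refine riemannHypothesis_of_riemannZeta_ne_zero fun s h0 h1 => ?_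
    exact (key _ (hsub _ ⟨h0, h1⟩)).1 (h _ ⟨h0, h1⟩) s rfl
  · refine (key c (hsub c hc)).2 fun s hs => h.riemannZeta_ne_zero ?_ ?_ ?_ <;> rw [hs]
    exacts [hc.1, (hsub c hc).2, hc.2.ne]
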